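/- A weak order on a set $S$ is a transitive binary relation $\le$ on $S$ such that $s\le t$ or $t\le s$ for all $s,t\in S$. Grouping tied elements ($s\le t$ and $t\le s$) turns a weak order on $\{1,\ldots,n\}$ into an ordered set-partition $(S_1,\ldots,S_k)$ of $\{1,\ldots,n\}$. Let two weak orders on $\{1,\ldots,n\}$ have ordered set-partitions $(S_1,\ldots,S_k)$ and $(T_1,\ldots,T_{k'})$. A left consecutive embedding in this pair is a consecutive pair of parts $S_i,S_{i+1}$ with $S_i\cup S_{i+1}\subseteq T_j$ for some $j$; a right consecutive embedding is a consecutive pair of parts $T_i,T_{i+1}$ with $T_i\cup T_{i+1}\subseteq S_j$ for some $j$; a consecutive embedding is a left or a right one. Let $f_n$ be the number of weak orders on $\{1,\ldots,n\}$, let $q_{n,0}$ be the number of ordered pairs of weak orders on $\{1,\ldots,n\}$, so that $q_{n,0}=f_n^2$, and let $q_n$ be the number of such pairs that have no consecutive embeddings. **Theorem.** As $n\to\infty$, \[q_n\sim e^{-(\log 2)^2}q_{n,0}=e^{-(\log 2)^2}f_n^2\sim e^{-(\log2)^2}\frac{n!^2}{4(\log2)^{2n+2}}.\] Thus the proportion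 $q_n/q_{n,0}$ of pairs of weak orders on $\{1,\ldots,n\}$ that have no consecutive embeddings tends to $e^{-(\log 2)^2}$, which is about $62\%$ (that is, $|e^{-(\log 2)^2}-0.62|<0.005$). -/

import Mathlib

open scoped Nat Asymptotics Topology

/-- A weak order on `S`: a transitive binary relation without incomparable pairs
(in particular it is reflexive; ties are allowed). -/
@[ext]
structure WeakOrder (S : Type*) where
  le : S → S → Prop
  trans : ∀ a b c : S, le a b → le b c → le a c
  total : ∀ a b : S, le a b ∨ le b a

namespace WeakOrder

variable {S : Type*}

/-- On a finite set there are finitely many weak orders, so that `Nat.card` below really counts. -/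
instance instFinite [Finite S] : Finite (WeakOrder S) :=
  Finite.of_injective (fun w : WeakOrder S => w.le) (fun _ _ h => WeakOrder.ext h)

/-- The set of all elements tied with `s`. -/
def tieClass (w : WeakOrder S) (s : S) : Set S := {t | w.le s t ∧ w.le t s}

/-- The parts `S₁, …, S_k` of the ordered set-partition given by the weak order:
the classes of the relation "tied". -/
def parts (w : WeakOrder S) : Set (Set S) := Set.range w.tieClass

/-- On parts: `A` comes strictly before `B` in the ordered set-partition. -/
def PartLT (w : WeakOrder S) (A B : Set S) : Prop := ∀ a ∈ A, ∀ b ∈ B, ¬ w.le b a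

/-- `A` and `B` are consecutive parts of the ordered set-partition,
that is `A = S_i` and `B = S_{i+1}` for some `i`. -/
def ConsecutiveParts (w : WeakOrder S) (A B : Set S) : Prop :=
  A ∈ w.parts ∧ B ∈ w.parts ∧ w.PartLT A B ∧
    ¬ ∃ C ∈ w.parts, w.PartLT A C ∧ w.PartLT C B

/-- `(A, B) = (S_i, S_{i+1})` is a consecutive pair of parts of `w` whose union lies in a
single part of `w'`. This is a left consecutive embedding in the pair `(w, w')`, and a right
consecutive embedding in the pair `(w', w)`. -/
def IsEmbedding (w w' : WeakOrder S) (A B : Set S) : Prop :=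
  w.ConsecutiveParts A B ∧ ∃ T ∈ w'.parts, A ∪ B ⊆ T

/-- `(A, B)` is a left consecutive embedding in the pair `p`. -/
def IsLeftConsecutiveEmbedding (p : WeakOrder S × WeakOrder S) (A B : Set S) : Prop :=
  IsEmbedding p.1 p.2 A B

/-- `(A, B)` is a right consecutive embedding in the pair `p`. -/
def IsRightConsecutiveEmbedding (p : WeakOrder S × WeakOrder S) (A B : Set S) : Prop :=
  IsEmbedding p.2 p.1 A B

/-- The pair `p` has no consecutive embedding, neither left nor right. -/
def NoConsecutiveEmbedding (p : WeakOrder S × WeakOrder S) : Prop :=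
  ∀ A B : Set S, ¬ IsLeftConsecutiveEmbedding p A B ∧ ¬ IsRightConsecutiveEmbedding p A B

end WeakOrder

/-- `f_n`: the number of weak orders on an `n`-element set (Fubini number). -/
noncomputable def fubini (n : ℕ) : ℕ := Nat.card (WeakOrder (Fin n))

/-- `q_{n,0}`: the number of all pairs of weak orders on an `n`-element set. -/
noncomputable def pairCount (n : ℕ) : ℕ := Nat.card (WeakOrder (Fin n) × WeakOrder (Fin n))

/-- `q_n`: the number of pairs of weak orders on an `n`-element set that have
no consecutive embeddings. -/
noncomputable def embeddingFreePairCount (n : ℕ) : ℕ :=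
  Nat.card {p : WeakOrder (Fin n) × WeakOrder (Fin n) // WeakOrder.NoConsecutiveEmbedding p}

/-! Call `({a}, {b})` a link if these are consecutive singleton parts of one order while `a` and `b`
are tied in the other. The number of links in a random pair is asymptotically Poisson with mean
$(\log 2)^2$, and embeddings other than links are negligible, so the probability of no embedding
tends to $e^{-(\log 2)^2}$.

The analytic input is $f_n(\log 2)^n/n!\to 1/(2\log 2)$ (`tendsto_scaledFubini`), proved by a
renewal argument from the recursion on the first part. It gives $f_{n-k}/f_n\sim(\log 2/n)^k$
(`tendsto_pow_mul_fubini_div`).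

A link determines the position of `b` from that of `a` in both orders, so deleting `b` loses no
information. In the order where the parts are singletons, `{a}` must remain a part, which has
probability about $1/2$: moving an element out of its part, or into the preceding one, nearly
matches the orders where it is alone with those where it is not. So $k$ disjoint links occur in
about $2^{-k}f_{n-k}^2$ pairs (`exists_card_disjoint_links`). There are about $2^kn^{2k}$ ordered
choices of them, and the $k$-th factorial moment tends to $(\log 2)^{2k}$. Overlapping choices
number only $O(n^{2k-1})$, each occurring in at most $f_{n-k}^2$ pairs (`card_links_le`).
Bonferroni's inequalities turn the moments into the probability of no link.

An embedding with a part of size at least 2 yields a witness of three or four elements that costs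
one more factor $1/n$ than its number of choices gains (`card_hasLargeEmbedding_le`). -/

namespace WeakOrder

variable {S T : Type*}

/-! ### Weak orders determined by their restriction to a subset -/

theorem le_refl (w : WeakOrder S) (a : S) : w.le a a := (w.total a a).elim id id

/-- The weak order pulled back along a map. -/
def comap (f : T → S) (w : WeakOrder S) : WeakOrder T where
  le a b := w.le (f a) (f b)
  trans _ _ _ := w.trans _ _ _
  total _ _ := w.total _ _

/-- Equivalent types have equivalent sets of weak orders. -/
def congr (e : T ≃ S) : WeakOrder S ≃ WeakOrder T where
  toFun := comap e
  invFun := comap e.symm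
  left_inv w := by ext; simp [comap]
  right_inv w := by ext; simp [comap]

theorem card_eq_fubini [Finite S] : Nat.card (WeakOrder S) = fubini (Nat.card S) :=
  Nat.card_congr (congr (Finite.equivFin S).symm)

/-- The indiscrete weak order. -/
instance : Inhabited (WeakOrder S) := ⟨⟨fun _ _ => True, by simp, by simp⟩⟩

/-- Two weak orders compare `x` and `y` in the same way. -/
def Agree (w v : WeakOrder S) (x y : S) : Prop :=
  (w.le x y ↔ v.le x y) ∧ (w.le y x ↔ v.le y x)

theorem Agree.symm {w v : WeakOrder S} {x y : S} (h : Agree w v x y) : Agree w v y x :=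
  ⟨h.2, h.1⟩

theorem agree_self (w v : WeakOrder S) (x : S) : Agree w v x x :=
  ⟨iff_of_true (w.le_refl x) (v.le_refl x), iff_of_true (w.le_refl x) (v.le_refl x)⟩

/-- The positions of the elements of `D` in `w` and `v` are determined, in the same way, by
those of elements of lower rank. -/
def Located (w v : WeakOrder S) (D : Finset S) : Prop :=
  ∃ r : S → ℕ, ∀ b ∈ D, ∀ y, y ≠ b → (∀ a, r a < r b → Agree w v a y) → Agree w v b y

/-- Induction on the sum of the two ranks reduces each comparison involving `D` to comparisons of
smaller rank sum, and finally to pairs outside `D`, where the restrictions decide. -/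
theorem Located.eq_of_comap_eq {w v : WeakOrder S} {D : Finset S} (h : Located w v D)
    (hc : comap (fun x : {x // x ∉ D} => x.1) w = comap (fun x : {x // x ∉ D} => x.1) v) :
    w = v := by
  obtain ⟨r, hr⟩ := h
  have key : ∀ n, ∀ x y, r x + r y = n → Agree w v x y := by
    intro n
    induction n using Nat.strong_induction_on with
    | _ n ih =>
      intro x y hn
      by_cases hxy : y = x
      · subst hxy; exact agree_self w v _
      by_cases hx : x ∈ D
      · exact hr x hx y hxy fun a ha => ih (r a + r y) (by omega) a y rfl
      by_cases hy : y ∈ D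
      · exact (hr y hy x (Ne.symm hxy) fun a ha => ih (r a + r x) (by omega) a x rfl).symm
      have h1 := congrFun (congrFun (congrArg WeakOrder.le hc) ⟨x, hx⟩) ⟨y, hy⟩
      have h2 := congrFun (congrFun (congrArg WeakOrder.le hc) ⟨y, hy⟩) ⟨x, hx⟩
      exact ⟨iff_of_eq h1, iff_of_eq h2⟩
  ext x y
  exact (key _ x y rfl).1

theorem card_compl_eq [Finite S] (D : Finset S) :
    Nat.card (WeakOrder {x // x ∉ D}) = fubini (Nat.card S - D.card) := by
  classical
  have := Fintype.ofFinite S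
  rw [card_eq_fubini]
  congr 1
  rw [Nat.card_eq_fintype_card, Fintype.card_subtype_compl, Nat.card_eq_fintype_card,
    Fintype.card_coe]

/-- Restriction to the complement of `D` is injective on the orders with `P`, so each located
element lowers the argument of `fubini` by one. The upper bounds on counts below rest on this and
its version for pairs. -/
theorem card_le_of_located [Finite S] {P : WeakOrder S → Prop} (D : Finset S)
    (h : ∀ w v, P w → P v → Located w v D) :
    Nat.card {w // P w} ≤ fubini (Nat.card S - D.card) := by
  rw [← card_compl_eq]
  refine Nat.card_le_card_of_injective
    (fun w : {w // P w} => comap (fun x : {x // x ∉ D} => x.1) w.1) fun w v hwv => ?_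
  exact Subtype.ext ((h w.1 v.1 w.2 v.2).eq_of_comap_eq hwv)

theorem card_pair_le_of_located [Finite S] {P : WeakOrder S × WeakOrder S → Prop}
    (D E : Finset S)
    (h : ∀ p q, P p → P q → Located p.1 q.1 D ∧ Located p.2 q.2 E) :
    Nat.card {p // P p} ≤ fubini (Nat.card S - D.card) * fubini (Nat.card S - E.card) := by
  rw [← card_compl_eq, ← card_compl_eq, ← Nat.card_prod]
  refine Nat.card_le_card_of_injective
    (fun p : {p // P p} => (comap (fun x : {x // x ∉ D} => x.1) p.1.1,
      comap (fun x : {x // x ∉ E} => x.1) p.1.2)) fun p q hpq => ?_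
  obtain ⟨h1, h2⟩ := h p.1 q.1 p.2 q.2
  rw [Prod.mk.injEq] at hpq
  exact Subtype.ext (Prod.ext (h1.eq_of_comap_eq hpq.1) (h2.eq_of_comap_eq hpq.2))

/-- `a` and `b` are tied. -/
def Tie (w : WeakOrder S) (a b : S) : Prop := w.le a b ∧ w.le b a

/-- `{a}` is a part. -/
def Single (w : WeakOrder S) (a : S) : Prop := ∀ y, w.le a y → w.le y a → y = a

/-- `{b}` is a part, immediately after the part of `a`. -/
def After (w : WeakOrder S) (a b : S) : Prop :=
  a ≠ b ∧ ∀ y, y ≠ b → (w.le b y ↔ ¬ w.le y a) ∧ (w.le y b ↔ w.le y a)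

/-- `{b}` is a part, immediately before the part of `a`. -/
def Before (w : WeakOrder S) (a b : S) : Prop :=
  a ≠ b ∧ ∀ y, y ≠ b → (w.le y b ↔ ¬ w.le a y) ∧ (w.le b y ↔ w.le a y)

/-- `{a}` and `{b}` are consecutive parts. -/
def Succ (w : WeakOrder S) (a b : S) : Prop := w.Single a ∧ w.After a b

/-- `{b}` is the first part. -/
def First (w : WeakOrder S) (b : S) : Prop := ∀ y, y ≠ b → w.le b y ∧ ¬ w.le y b

variable {w v : WeakOrder S} {a b y : S}

theorem Tie.symm (h : w.Tie a b) : w.Tie b a := ⟨h.2, h.1⟩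

theorem Tie.trans {c : S} (h : w.Tie a b) (h' : w.Tie b c) : w.Tie a c :=
  ⟨w.trans _ _ _ h.1 h'.1, w.trans _ _ _ h'.2 h.2⟩

theorem Tie.le_left_iff (h : w.Tie a b) : w.le a y ↔ w.le b y :=
  ⟨w.trans _ _ _ h.2, w.trans _ _ _ h.1⟩

theorem Tie.le_right_iff (h : w.Tie a b) : w.le y a ↔ w.le y b :=
  ⟨fun k => w.trans _ _ _ k h.1, fun k => w.trans _ _ _ k h.2⟩

theorem Tie.agree (hw : w.Tie a b) (hv : v.Tie a b) (h : Agree w v a y) : Agree w v b y :=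
  ⟨by rw [← hw.le_left_iff, ← hv.le_left_iff, h.1],
    by rw [← hw.le_right_iff, ← hv.le_right_iff, h.2]⟩

theorem After.agree (hw : w.After a b) (hv : v.After a b) (hy : y ≠ b) (h : Agree w v a y) :
    Agree w v b y :=
  ⟨by rw [(hw.2 y hy).1, (hv.2 y hy).1, h.2], by rw [(hw.2 y hy).2, (hv.2 y hy).2, h.2]⟩

theorem Before.agree (hw : w.Before a b) (hv : v.Before a b) (hy : y ≠ b)
    (h : Agree w v a y) : Agree w v b y :=
  ⟨by rw [(hw.2 y hy).2, (hv.2 y hy).2, h.1], by rw [(hw.2 y hy).1, (hv.2 y hy).1, h.1]⟩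

theorem First.agree (hw : w.First b) (hv : v.First b) (hy : y ≠ b) : Agree w v b y :=
  ⟨iff_of_true (hw y hy).1 (hv y hy).1, iff_of_false (hw y hy).2 (hv y hy).2⟩

theorem After.le (h : w.After a b) : w.le a b := ((h.2 a h.1).2).2 (w.le_refl a)

theorem After.not_le (h : w.After a b) : ¬ w.le b a :=
  fun k => ((h.2 a h.1).1).1 k (w.le_refl a)

theorem After.single (h : w.After a b) : w.Single b := fun y h1 h2 => by
  by_contra hy
  exact ((h.2 y hy).1).1 h1 (((h.2 y hy).2).1 h2)

theorem Succ.eq_of_succ {a' : S} (h : w.Succ a b) (h' : w.Succ a' b) : a = a' := by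
  have h1 := (h.2.2 a' h'.2.1).2.1 h'.2.le
  have h2 := (h'.2.2 a h.2.1).2.1 h.2.le
  exact h'.1 a h1 h2

/-- `b ∈ D` is located relative to an element outside of `D`. -/
theorem located_of_star {D : Finset S}
    (h : ∀ b ∈ D, (∃ a ∉ D, (w.Tie a b ∧ v.Tie a b) ∨ (w.After a b ∧ v.After a b) ∨
      (w.Before a b ∧ v.Before a b)) ∨ (w.First b ∧ v.First b)) : Located w v D := by
  classical
  refine ⟨fun x => if x ∈ D then 1 else 0, fun b hb y hy hr => ?_⟩
  rcases h b hb with ⟨a, ha, h1 | h1 | h1⟩ | h1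
  · exact h1.1.agree h1.2 (hr a (by simp [ha, hb]))
  · exact h1.1.agree h1.2 hy (hr a (by simp [ha, hb]))
  · exact h1.1.agree h1.2 hy (hr a (by simp [ha, hb]))
  · exact h1.1.agree h1.2 hy

end WeakOrder

/-! ### The recursion for Fubini numbers -/

namespace WeakOrder

variable {S : Type*}

/-- The weak order with first part `B` (if nonempty) that continues as `v`. -/
def bottomExtend (B : Finset S) (v : WeakOrder {x // x ∉ B}) : WeakOrder S where
  le x y := x ∈ B ∨ ∃ (hx : x ∉ B) (hy : y ∉ B), v.le ⟨x, hx⟩ ⟨y, hy⟩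
  trans a b c := by
    rintro (h | ⟨ha, hb, h⟩) (h' | ⟨hb', hc, h'⟩)
    · exact Or.inl h
    · exact Or.inl h
    · exact absurd h' hb
    · exact Or.inr ⟨ha, hc, v.trans _ _ _ h h'⟩
  total a b := by
    by_cases ha : a ∈ B
    · exact Or.inl (Or.inl ha)
    by_cases hb : b ∈ B
    · exact Or.inr (Or.inl hb)
    exact (v.total ⟨a, ha⟩ ⟨b, hb⟩).imp (fun h => Or.inr ⟨ha, hb, h⟩)
      (fun h => Or.inr ⟨hb, ha, h⟩)

/-- Restriction to the complement of `B` is a bijection with inverse `bottomExtend`. For empty `B`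
that inverse would fail, since the minimal elements of `v` would form the first part. -/
theorem card_bottom_eq [Finite S] (B : Finset S) (hB : B.Nonempty) :
    Nat.card {w : WeakOrder S // ∀ x, x ∈ B ↔ ∀ y, w.le x y} =
      fubini (Nat.card S - B.card) := by
  rw [← card_compl_eq]
  refine Nat.card_congr (Equiv.ofBijective
    (fun w => comap (fun x : {x // x ∉ B} => x.1) w.1) ⟨fun w v hwv => ?_, fun v => ?_⟩)
  · apply Subtype.ext
    ext x y
    by_cases hx : x ∈ B
    · exact iff_of_true ((w.2 x).1 hx y) ((v.2 x).1 hx y)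
    by_cases hy : y ∈ B
    · refine iff_of_false (fun h => hx ?_) (fun h => hx ?_)
      · exact (w.2 x).2 fun z => w.1.trans _ _ _ h ((w.2 y).1 hy z)
      · exact (v.2 x).2 fun z => v.1.trans _ _ _ h ((v.2 y).1 hy z)
    exact iff_of_eq (congrFun (congrFun (congrArg WeakOrder.le hwv) ⟨x, hx⟩) ⟨y, hy⟩)
  · refine ⟨⟨bottomExtend B v, fun x => ⟨fun h y => Or.inl h, fun h => ?_⟩⟩, ?_⟩
    · obtain ⟨b, hb⟩ := hB
      rcases h b with h | ⟨_, h, _⟩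
      · exact h
      · exact absurd hb h
    · ext ⟨x, hx⟩ ⟨y, hy⟩
      simp [bottomExtend, comap, hx, hy]

theorem exists_forall_le [Finite S] [Nonempty S] (w : WeakOrder S) : ∃ x, ∀ y, w.le x y := by
  let _ : Preorder S := { le := w.le, le_refl := w.le_refl, le_trans := w.trans }
  obtain ⟨x, hx⟩ := (Set.finite_univ (α := S)).exists_minimal Set.univ_nonempty
  exact ⟨x, fun y => (w.total x y).elim id fun h => hx.2 trivial h⟩

end WeakOrder

theorem fubini_zero : fubini 0 = 1 := by
  rw [fubini, Nat.card_eq_one_iff_unique]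
  exact ⟨⟨fun w v => by ext x; exact x.elim0⟩, ⟨default⟩⟩

theorem fubini_pos (n : ℕ) : 0 < fubini n := Nat.card_pos

/-- A weak order is determined by its first part and the weak order on the rest. -/
theorem sum_choose_mul_fubini {n : ℕ} (hn : n ≠ 0) :
    ∑ m ∈ Finset.range (n + 1), n.choose m * fubini (n - m) = 2 * fubini n := by
  classical
  have : Nonempty (Fin n) := ⟨⟨0, Nat.pos_of_ne_zero hn⟩⟩
  let bot : WeakOrder (Fin n) → Finset (Fin n) := fun w => {x | ∀ y, w.le x y}
  have hbot : ∀ w B, bot w = B ↔ ∀ x, x ∈ B ↔ ∀ y, w.le x y := by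
    intro w B
    simp only [bot, Finset.ext_iff, Finset.mem_filter, Finset.mem_univ, true_and]
    exact forall_congr' fun x => Iff.comm
  have := Fintype.ofFinite (WeakOrder (Fin n))
  have h1 : fubini n = ∑ B ∈ (Finset.univ : Finset (Fin n)).powerset.erase ∅,
      fubini (n - B.card) := by
    rw [fubini, Nat.card_eq_fintype_card, ← Finset.card_univ,
      Finset.card_eq_sum_card_fiberwise (f := bot)
        (t := (Finset.univ : Finset (Fin n)).powerset.erase ∅)]
    · refine Finset.sum_congr rfl fun B hB => ?_
      have h2 := WeakOrder.card_bottom_eq B (Finset.nonempty_iff_ne_empty.2 (Finset.mem_erase.1 hB).1)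
      rw [Nat.card_eq_fintype_card, Nat.card_eq_fintype_card, Fintype.card_fin] at h2
      rw [← h2, Fintype.card_subtype]
      congr 1
      ext w
      simp [hbot]
    · intro w _
      obtain ⟨x, hx⟩ := w.exists_forall_le
      simp only [Finset.coe_erase, Set.mem_sdiff, Finset.mem_coe, Finset.mem_powerset,
        Finset.subset_univ, Set.mem_singleton_iff, true_and]
      exact Finset.Nonempty.ne_empty ⟨x, by simp [bot, hx]⟩
  have h2 := Finset.sum_powerset_apply_card (fun m => fubini (n - m)) (x := (Finset.univ : Finset (Fin n)))
  -- First parts are nonempty; the missing term of `∅` is `fubini n` itself, whence the factor 2.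
  rw [← Finset.add_sum_erase _ _ (Finset.mem_powerset.2 (Finset.empty_subset _)), ← h1] at h2
  simp only [Finset.card_empty, Finset.card_univ, Fintype.card_fin, smul_eq_mul, Nat.sub_zero] at h2
  rw [← h2]; ring

/-! ### Asymptotics of Fubini numbers by a renewal argument -/

section

open Filter Finset

/-- `f_n (log 2)^n / n!`. -/
noncomputable def scaledFubini (n : ℕ) : ℝ := fubini n * Real.log 2 ^ n / n !

/-- The tails `∑_{k > j} (log 2)^k / k!` of the exponential series. -/
noncomputable def expTail (j : ℕ) : ℝ := 2 - ∑ k ∈ range (j + 1), Real.log 2 ^ k / k !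

theorem hasSum_log_two_pow_div_factorial :
    HasSum (fun k : ℕ => Real.log 2 ^ k / k !) 2 := by
  have h := NormedSpace.expSeries_div_hasSum_exp (Real.log 2)
  rwa [← Real.exp_eq_exp_ℝ, Real.exp_log two_pos] at h

theorem log_two_pos : 0 < Real.log 2 := Real.log_pos one_lt_two

theorem expTail_nonneg (j : ℕ) : 0 ≤ expTail j := by
  have := sum_le_hasSum (range (j + 1))
    (fun k _ => div_nonneg (pow_nonneg log_two_pos.le k) (Nat.cast_nonneg (k !)))
    hasSum_log_two_pow_div_factorial
  unfold expTail; linarith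

theorem expTail_succ (j : ℕ) :
    expTail (j + 1) = expTail j - Real.log 2 ^ (j + 1) / (j + 1)! := by
  rw [expTail, sum_range_succ, expTail]; ring

theorem hasSum_mul_log_two_pow_div_factorial :
    HasSum (fun k : ℕ => (k : ℝ) * (Real.log 2 ^ k / k !)) (2 * Real.log 2) := by
  rw [← hasSum_nat_add_iff' 1]
  have h : (fun k : ℕ => ((k + 1 : ℕ) : ℝ) * (Real.log 2 ^ (k + 1) / (k + 1)!)) =
      fun k : ℕ => Real.log 2 ^ k / k ! * Real.log 2 := by
    funext k
    rw [Nat.factorial_succ]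
    push_cast
    have : (k ! : ℝ) ≠ 0 := by positivity
    field_simp
    ring
  rw [h]
  simpa using hasSum_log_two_pow_div_factorial.mul_right (Real.log 2)

theorem sum_expTail (n : ℕ) : ∑ j ∈ range n, expTail j =
    n * expTail n + ∑ k ∈ range (n + 1), (k : ℝ) * (Real.log 2 ^ k / k !) := by
  induction n with
  | zero => simp
  | succ n ih =>
    rw [sum_range_succ, ih, sum_range_succ _ (n + 1), expTail_succ]
    push_cast; ring

theorem mul_expTail_le (n : ℕ) : n * expTail n ≤
    2 * Real.log 2 - ∑ k ∈ range (n + 1), (k : ℝ) * (Real.log 2 ^ k / k !) := by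
  have h1 := (hasSum_nat_add_iff' (n + 1)).2 hasSum_log_two_pow_div_factorial
  have h2 := (hasSum_nat_add_iff' (n + 1)).2 hasSum_mul_log_two_pow_div_factorial
  refine hasSum_le (fun k => ?_) (h1.mul_left (n : ℝ)) h2
  have h0 := log_two_pos
  gcongr
  exact_mod_cast (by omega : n ≤ k + (n + 1))

/-- Summation by parts turns the sum of the tails into $\sum_k k(\log 2)^k/k! = 2\log 2$. The
boundary term `n * expTail n` is at most the tail of that series, since $n\le k$ there, so the
partial sums are squeezed. -/
theorem hasSum_expTail : HasSum expTail (2 * Real.log 2) := by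
  rw [hasSum_iff_tendsto_nat_of_nonneg expTail_nonneg]
  have h := (tendsto_add_atTop_iff_nat 1).2
    hasSum_mul_log_two_pow_div_factorial.tendsto_sum_nat
  refine tendsto_of_tendsto_of_tendsto_of_le_of_le h tendsto_const_nhds (fun n => ?_) fun n => ?_
  · simp only [sum_expTail]
    have := mul_nonneg (Nat.cast_nonneg (α := ℝ) n) (expTail_nonneg n)
    linarith
  · simp only [sum_expTail]
    linarith [mul_expTail_le n]

/-- This is the recursion multiplied by $(\log 2)^n/n!$. The correction at $n=0$, where the
recursion fails, becomes the source term of the renewal equation. -/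
theorem sum_scaledFubini (n : ℕ) :
    ∑ k ∈ range (n + 1), Real.log 2 ^ k / k ! * scaledFubini (n - k) =
      2 * scaledFubini n - if n = 0 then 1 else 0 := by
  rcases eq_or_ne n 0 with rfl | hn
  · simp [scaledFubini, fubini_zero]; norm_num
  · rw [if_neg hn, sub_zero, scaledFubini, mul_div_assoc, ← mul_assoc]
    have h : (2 : ℝ) * fubini n = ((2 * fubini n : ℕ) : ℝ) := by push_cast; ring
    rw [h, ← sum_choose_mul_fubini hn, Nat.cast_sum, sum_mul]
    refine sum_congr rfl fun k hk => ?_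
    have hk : k ≤ n := by simpa [Nat.lt_succ_iff] using hk
    rw [scaledFubini, Nat.cast_mul, Nat.cast_choose ℝ hk, ← Nat.add_sub_cancel' hk, pow_add,
      Nat.add_sub_cancel' hk]
    have h1 : (k ! : ℝ) ≠ 0 := by positivity
    have h2 : ((n - k)! : ℝ) ≠ 0 := by positivity
    have h3 : (n ! : ℝ) ≠ 0 := by positivity
    field_simp

/-- The increments of `scaledFubini`. -/
noncomputable def scaledFubiniDiff : ℕ → ℝ
  | 0 => scaledFubini 0
  | n + 1 => scaledFubini (n + 1) - scaledFubini n

theorem sum_scaledFubiniDiff (n : ℕ) :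
    ∑ k ∈ range (n + 1), scaledFubiniDiff k = scaledFubini n := by
  induction n with
  | zero => simp [scaledFubiniDiff]
  | succ n ih => rw [sum_range_succ, ih, scaledFubiniDiff]; ring

open PowerSeries in
/-- The renewal equation. -/
theorem sum_antidiagonal_expTail_mul (n : ℕ) :
    ∑ p ∈ antidiagonal n, expTail p.1 * scaledFubiniDiff p.2 = if n = 0 then 1 else 0 := by
  let E : PowerSeries ℝ := PowerSeries.mk fun k => Real.log 2 ^ k / (k ! : ℝ)
  let U : PowerSeries ℝ := PowerSeries.mk scaledFubini
  -- Since $E(1)=2$, the series $2-E$ vanishes at 1. Dividing it by $1-X$ gives the tails,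
  -- multiplying $U$ by $1-X$ gives the increments, and $(2-E)U=1$ is unaffected.
  have hT : PowerSeries.mk expTail * (1 - X) = C (2 : ℝ) - E := by
    ext k
    cases k with
    | zero => simp [E, expTail]
    | succ k =>
      rw [mul_sub, mul_one, map_sub, coeff_succ_mul_X, coeff_mk, coeff_mk, expTail_succ]
      simp [E]
  have hD : PowerSeries.mk scaledFubiniDiff = (1 - X) * U := by
    ext k
    cases k with
    | zero => simp [U, scaledFubiniDiff]
    | succ k => simp [sub_mul, U, scaledFubiniDiff, coeff_succ_X_mul]
  have hEU : (C (2 : ℝ) - E) * U = 1 := by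
    ext k
    rw [sub_mul, map_sub, coeff_C_mul, coeff_mul, Nat.sum_antidiagonal_eq_sum_range_succ_mk]
    simp only [E, U, coeff_mk, sum_scaledFubini, coeff_one]
    ring
  have := congrArg (coeff n) (show PowerSeries.mk expTail * PowerSeries.mk scaledFubiniDiff = 1 by
    rw [hD, ← mul_assoc, hT, hEU])
  rw [coeff_mul, coeff_one] at this
  simpa using this

/-- The tail of index 0 is 1 and all tails sum to $2\log 2<2$, so the remaining ones sum to less
than 1. Solving the renewal equation for its last increment is therefore a contraction: the partial
sums $s$ of absolute values satisfy $s\le 1+(2\log 2-1)s$. -/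
theorem summable_abs_scaledFubiniDiff : Summable fun n => |scaledFubiniDiff n| := by
  have hlog : Real.log 2 < 0.7 := by have := Real.log_two_lt_d9; linarith
  refine summable_of_sum_range_le (c := 2) (fun n => abs_nonneg _) fun N => ?_
  have h0 : expTail 0 = 1 := by norm_num [expTail]
  have hstep : ∀ n, |scaledFubiniDiff n| ≤ (if n = 0 then 1 else 0) +
      (∑ k ∈ range (n + 1), expTail k * |scaledFubiniDiff (n - k)| - |scaledFubiniDiff n|) := by
    intro n
    have h := sum_antidiagonal_expTail_mul n
    rw [Nat.sum_antidiagonal_eq_sum_range_succ_mk, sum_range_succ'] at h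
    rw [sum_range_succ']
    simp only [h0, one_mul, Nat.sub_zero] at h ⊢
    have h2 : scaledFubiniDiff n = (if n = 0 then 1 else 0) -
      ∑ k ∈ range n, expTail (k + 1) * scaledFubiniDiff (n - (k + 1)) := by linarith
    have h3 : |∑ k ∈ range n, expTail (k + 1) * scaledFubiniDiff (n - (k + 1))| ≤
        ∑ k ∈ range n, expTail (k + 1) * |scaledFubiniDiff (n - (k + 1))| := by
      refine (abs_sum_le_sum_abs _ _).trans (le_of_eq (sum_congr rfl fun k _ => ?_))
      rw [abs_mul, abs_of_nonneg (expTail_nonneg _)]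
    have h4 : |scaledFubiniDiff n| ≤ |(if n = 0 then 1 else 0 : ℝ)| +
        |∑ k ∈ range n, expTail (k + 1) * scaledFubiniDiff (n - (k + 1))| := by
      conv_lhs => rw [h2]
      exact abs_sub _ _
    have h5 : |(if n = 0 then 1 else 0 : ℝ)| = if n = 0 then 1 else 0 := by
      split_ifs <;> simp
    rw [h5] at h4
    linarith
  have hsum := sum_le_sum fun n (_ : n ∈ range N) => hstep n
  rw [sum_add_distrib, sum_sub_distrib, sum_range_diag_flip N
    fun k j => expTail k * |scaledFubiniDiff j|] at hsum
  have hone : ∑ n ∈ range N, (if n = 0 then 1 else 0 : ℝ) ≤ 1 := by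
    rw [sum_ite_eq']; split_ifs <;> norm_num
  set s := ∑ n ∈ range N, |scaledFubiniDiff n|
  have hs : 0 ≤ s := sum_nonneg fun _ _ => abs_nonneg _
  have hprod : ∑ m ∈ range N, ∑ k ∈ range (N - m), expTail m * |scaledFubiniDiff k| ≤
      2 * Real.log 2 * s := by
    calc _ ≤ ∑ m ∈ range N, expTail m * s := by
          refine sum_le_sum fun m _ => ?_
          rw [← mul_sum]
          refine mul_le_mul_of_nonneg_left ?_ (expTail_nonneg m)
          exact sum_le_sum_of_subset_of_nonneg (range_mono (Nat.sub_le _ _))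
            fun _ _ _ => abs_nonneg _
      _ = (∑ m ∈ range N, expTail m) * s := by rw [sum_mul]
      _ ≤ _ := mul_le_mul_of_nonneg_right
          (sum_le_hasSum _ (fun j _ => expTail_nonneg j) hasSum_expTail) hs
  nlinarith

/-- The limit is the sum of the increments. By the renewal equation the Cauchy product with the
tails is 1, and the tails sum to $2\log 2$. -/
theorem tendsto_scaledFubini :
    Tendsto scaledFubini atTop (𝓝 (1 / (2 * Real.log 2))) := by
  have hd : Summable scaledFubiniDiff := summable_abs_scaledFubiniDiff.of_abs
  have h1 : Tendsto scaledFubini atTop (𝓝 (∑' n, scaledFubiniDiff n)) := by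
    refine ((tendsto_add_atTop_iff_nat 1).2 hd.hasSum.tendsto_sum_nat).congr fun n => ?_
    exact sum_scaledFubiniDiff n
  have h2 := tsum_mul_tsum_eq_tsum_sum_antidiagonal_of_summable_norm
    (f := expTail) (g := scaledFubiniDiff) hasSum_expTail.summable.norm
    summable_abs_scaledFubiniDiff
  simp only [sum_antidiagonal_expTail_mul, tsum_ite_eq, hasSum_expTail.tsum_eq] at h2
  rwa [← eq_one_div_of_mul_eq_one_right h2]

/-- `n f_{n-1} / f_n → log 2`. -/
theorem tendsto_fubini_ratio :
    Tendsto (fun n : ℕ => ((n : ℝ) + 1) * fubini n / fubini (n + 1)) atTop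
      (𝓝 (Real.log 2)) := by
  have hl := log_two_pos
  have hc : (1 / (2 * Real.log 2)) ≠ 0 := by positivity
  have h := (tendsto_scaledFubini.div ((tendsto_add_atTop_iff_nat 1).2 tendsto_scaledFubini)
    hc).mul_const (Real.log 2)
  rw [div_self hc, one_mul] at h
  refine h.congr fun n => ?_
  have h1 : (fubini (n + 1) : ℝ) ≠ 0 := by exact_mod_cast (fubini_pos _).ne'
  have h2 : (n ! : ℝ) ≠ 0 := by positivity
  have h3 : (n : ℝ) + 1 ≠ 0 := by positivity
  simp only [Pi.div_apply, scaledFubini, Nat.factorial_succ, Nat.cast_mul, Nat.cast_add,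
    Nat.cast_one, pow_succ]
  field_simp

end

/-! ### Orders with prescribed singleton parts -/

namespace WeakOrder

variable {S : Type*}

theorem exists_forall_ge_of_finite [Finite S] (w : WeakOrder S) {A : Set S} (hA : A.Nonempty) :
    ∃ x ∈ A, ∀ y ∈ A, w.le y x := by
  let _ : Preorder S := { le := w.le, le_refl := w.le_refl, le_trans := w.trans }
  obtain ⟨x, hx⟩ := A.toFinite.exists_maximal hA
  exact ⟨x, hx.1, fun y hy => (w.total y x).elim id fun h => hx.2 hy h⟩

/-- Move `x` into a part of its own, immediately after its old part. -/
def moveOut (x : S) (w : WeakOrder S) : WeakOrder S where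
  le y z := (y = x → z = x ∨ ¬ w.le z x) ∧ (y ≠ x → w.le y z)
  trans a b c := by
    rintro ⟨h1, h2⟩ ⟨h3, h4⟩
    by_cases ha : a = x
    · refine ⟨fun _ => ?_, fun h => absurd ha h⟩
      by_cases hb : b = x
      · exact h3 hb
      · exact Or.inr fun hc => ((h1 ha).resolve_left hb) (w.trans _ _ _ (h4 hb) hc)
    · refine ⟨fun h => absurd h ha, fun _ => ?_⟩
      by_cases hb : b = x
      · rcases h3 hb with rfl | hc
        · exact hb ▸ h2 ha
        · exact w.trans _ _ _ (hb ▸ h2 ha) ((w.total x c).resolve_right hc)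
      · exact w.trans _ _ _ (h2 ha) (h4 hb)
  total a b := by
    by_cases ha : a = x <;> by_cases hb : b = x
    · exact Or.inl ⟨fun _ => Or.inl hb, fun h => absurd ha h⟩
    · by_cases h : w.le b x
      · exact Or.inr ⟨fun h => absurd h hb, fun _ => ha ▸ h⟩
      · exact Or.inl ⟨fun _ => Or.inr h, fun h => absurd ha h⟩
    · by_cases h : w.le a x
      · exact Or.inl ⟨fun h => absurd h ha, fun _ => hb ▸ h⟩
      · exact Or.inr ⟨fun _ => Or.inr h, fun h => absurd hb h⟩
    · exact (w.total a b).imp (fun h => ⟨fun h => absurd h ha, fun _ => h⟩)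
        (fun h => ⟨fun h => absurd h hb, fun _ => h⟩)

theorem single_moveOut (x : S) (w : WeakOrder S) : (w.moveOut x).Single x := fun y h1 h2 => by
  by_contra hy
  exact ((h1.1 rfl).resolve_left hy) (h2.2 hy)

theorem Single.moveOut {x a : S} {w : WeakOrder S} (h : w.Single a) : (w.moveOut x).Single a := by
  by_cases ha : a = x
  · exact ha ▸ single_moveOut x w
  intro y h1 h2
  by_cases hy : y = x
  · exact absurd (hy ▸ h1.2 ha) ((h2.1 hy).resolve_left ha)
  · exact h y (h1.2 ha) (h2.2 hy)

theorem not_single_iff {x : S} {w : WeakOrder S} :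
    ¬ w.Single x ↔ ∃ z, z ≠ x ∧ w.Tie x z := by
  simp only [Single, Tie]
  push Not
  exact exists_congr fun z => by tauto

/-- Comparisons `y ≤ z` with `y ≠ x` survive `moveOut`, and the position of `x` is recovered from an
element tied with it. With the roles exchanged, this makes `moveOut x` injective on orders where `x`
is not alone. -/
theorem le_of_moveOut_eq {x : S} {w v : WeakOrder S} (hw : ¬ w.Single x) (hv : ¬ v.Single x)
    (h : w.moveOut x = v.moveOut x) {y z : S} (hyz : w.le y z) : v.le y z := by
  have key : ∀ y z, y ≠ x → (w.le y z ↔ v.le y z) := by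
    intro y z hy
    have := iff_of_eq (congrFun (congrFun (congrArg WeakOrder.le h) y) z)
    simpa [moveOut, hy] using this
  by_cases hy : y = x
  · subst hy
    obtain ⟨s, hs, hws⟩ := not_single_iff.1 hw
    obtain ⟨t, ht, hvt⟩ := not_single_iff.1 hv
    have h1 : w.le t y := (key t y ht).2 hvt.2
    exact v.trans _ _ _ hvt.1 ((key t z ht).1 (w.trans _ _ _ h1 hyz))
  · exact (key y z hy).1 hyz

/-- Move `x` into the preceding part. -/
def moveIn (x : S) (w : WeakOrder S) : WeakOrder S where
  le y z := (y ≠ x → w.le y z) ∧ (y = x → ∀ t, t ≠ x → w.le t x → w.le t z)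
  trans a b c := by
    rintro ⟨h1, h2⟩ ⟨h3, h4⟩
    by_cases ha : a = x
    · refine ⟨fun h => absurd ha h, fun _ t ht htx => ?_⟩
      by_cases hb : b = x
      · exact h4 hb t ht htx
      · exact w.trans _ _ _ (h2 ha t ht htx) (h3 hb)
    · refine ⟨fun _ => ?_, fun h => absurd h ha⟩
      by_cases hb : b = x
      · exact h4 hb a ha (hb ▸ h1 ha)
      · exact w.trans _ _ _ (h1 ha) (h3 hb)
  total a b := by
    by_cases ha : a = x <;> by_cases hb : b = x
    · exact Or.inl ⟨fun h => absurd ha h, fun _ t _ h => hb ▸ h⟩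
    · rcases w.total x b with h | h
      · exact Or.inl ⟨fun h => absurd ha h, fun _ t _ ht => w.trans _ _ _ ht h⟩
      · exact Or.inr ⟨fun _ => ha ▸ h, fun h => absurd h hb⟩
    · rcases w.total x a with h | h
      · exact Or.inr ⟨fun h => absurd hb h, fun _ t _ ht => w.trans _ _ _ ht h⟩
      · exact Or.inl ⟨fun _ => hb ▸ h, fun h => absurd h ha⟩
    · exact (w.total a b).imp (fun h => ⟨fun _ => h, fun h => absurd h ha⟩)
        (fun h => ⟨fun _ => h, fun h => absurd h hb⟩)

theorem Single.le_iff {x z : S} {w : WeakOrder S} (h : w.Single x) (hz : z ≠ x) :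
    w.le x z ↔ ¬ w.le z x :=
  ⟨fun h1 h2 => hz (h z h1 h2), fun h1 => (w.total x z).resolve_right h1⟩

theorem eq_of_moveIn_eq {x : S} {w v : WeakOrder S} (hw : w.Single x) (hv : v.Single x)
    (h : w.moveIn x = v.moveIn x) : w = v := by
  have key : ∀ y z, y ≠ x → (w.le y z ↔ v.le y z) := by
    intro y z hy
    have := iff_of_eq (congrFun (congrFun (congrArg WeakOrder.le h) y) z)
    simpa [moveIn, hy] using this
  ext y z
  by_cases hy : y = x
  · subst hy
    by_cases hz : z = y
    · subst hz; exact iff_of_true (w.le_refl _) (v.le_refl _)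
    · rw [hw.le_iff hz, hv.le_iff hz, key z y hz]
  · exact key y z hy

/-- The singleton `{a}` can only be spoilt by receiving `x`, which happens when it is the part just
before `{x}`. -/
theorem Single.moveIn {x a : S} {w : WeakOrder S} (hx : w.Single x) (h : w.Single a) (ha : a ≠ x)
    (hax : ¬ w.After a x) : (w.moveIn x).Single a := by
  intro y h1 h2
  by_cases hy : y = x
  · refine absurd ⟨ha, fun z hz => ?_⟩ hax
    have h3 : w.le z x ↔ w.le z a := ⟨h2.2 hy z hz, fun h => w.trans _ _ _ h (hy ▸ h1.1 ha)⟩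
    exact ⟨by rw [hx.le_iff hz, h3], h3⟩
  · exact h y (h1.1 ha) (h2.1 hy)

theorem not_single_moveIn [Finite S] {x : S} {w : WeakOrder S} (hx : w.Single x)
    (hf : ¬ w.First x) : ¬ (w.moveIn x).Single x := by
  have hne : {t | t ≠ x ∧ w.le t x}.Nonempty := by
    simp only [First, not_forall] at hf
    obtain ⟨y, hy, h⟩ := hf
    rw [hx.le_iff hy, and_self, not_not] at h
    exact ⟨y, hy, h⟩
  obtain ⟨t, ⟨ht, htx⟩, hmax⟩ := w.exists_forall_ge_of_finite hne
  exact fun h => ht (h t ⟨fun h => absurd rfl h, fun _ s hs hsx => hmax s ⟨hs, hsx⟩⟩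
    ⟨fun _ => htx, fun h => absurd h ht⟩)

/-- The number of weak orders in which all elements of `R` form parts of their own. -/
noncomputable def singleCount (R : Finset S) : ℕ :=
  Nat.card {w : WeakOrder S // ∀ a ∈ R, w.Single a}

theorem singleCount_empty [Finite S] : singleCount (∅ : Finset S) = fubini (Nat.card S) := by
  rw [← card_eq_fubini, singleCount]
  exact Nat.card_congr (Equiv.subtypeUnivEquiv (by simp))

theorem card_first_le [Finite S] (x : S) :
    Nat.card {w : WeakOrder S // w.First x} ≤ fubini (Nat.card S - 1) :=
  card_le_of_located {x} fun _ _ hw hv => located_of_star fun b hb => by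
    rw [Finset.mem_singleton] at hb
    exact Or.inr (hb ▸ ⟨hw, hv⟩)

theorem card_after_le [Finite S] (a x : S) :
    Nat.card {w : WeakOrder S // w.After a x} ≤ fubini (Nat.card S - 1) :=
  card_le_of_located {x} fun _ _ hw hv => located_of_star fun b hb => by
    rw [Finset.mem_singleton] at hb
    exact Or.inl ⟨a, by simpa using hw.1, Or.inr (Or.inl (hb ▸ ⟨hw, hv⟩))⟩

-- Among the orders where `R` consists of singletons, `moveOut` injects those where `x` is not alone
-- into those where it is. Conversely `moveIn` is injective, except that orders with `x` first or
-- directly after some `{a}`, `a ∈ R`, must be omitted; each of these `R.card + 1` cases accounts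
-- for at most `fubini (Nat.card S - 1)` orders.
open Classical in
theorem abs_two_mul_singleCount_insert_sub_le [Finite S] {R : Finset S} {x : S} (hx : x ∉ R) :
    |(2 : ℝ) * singleCount (insert x R) - singleCount R| ≤
      (R.card + 1) * fubini (Nat.card S - 1) := by
  have := Fintype.ofFinite (WeakOrder S)
  let A : Finset (WeakOrder S) := {w | w.Single x ∧ ∀ a ∈ R, w.Single a}
  let B : Finset (WeakOrder S) := {w | ¬ w.Single x ∧ ∀ a ∈ R, w.Single a}
  have hA : singleCount (insert x R) = A.card := by
    rw [singleCount, Nat.card_eq_fintype_card, Fintype.card_subtype]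
    congr 1; ext w; simp [A]
  have hR : singleCount R = A.card + B.card := by
    rw [← Finset.card_union_of_disjoint, singleCount, Nat.card_eq_fintype_card,
      Fintype.card_subtype]
    · congr 1; ext w; simp only [A, B, Finset.mem_filter, Finset.mem_univ, Finset.mem_union]; tauto
    · rw [Finset.disjoint_left]; intro w; simp only [A, B, Finset.mem_filter]; tauto
  have h1 : B.card ≤ A.card := by
    refine Finset.card_le_card_of_injOn (moveOut x) (fun w hw => ?_) fun w hw v hv h => ?_
    · simp only [A, B, Finset.coe_filter, Set.mem_ofPred_eq, Finset.mem_univ, true_and] at hw ⊢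
      exact ⟨single_moveOut x w, fun a ha => (hw.2 a ha).moveOut⟩
    · simp only [B, Finset.coe_filter, Set.mem_ofPred_eq, Finset.mem_univ, true_and] at hw hv
      ext y z
      exact ⟨le_of_moveOut_eq hw.1 hv.1 h, le_of_moveOut_eq hv.1 hw.1 h.symm⟩
  let F : Finset (WeakOrder S) := {w | w.First x}
  let G : S → Finset (WeakOrder S) := fun a => {w | w.After a x}
  have h2 : (A \ (F ∪ R.biUnion G)).card ≤ B.card := by
    refine Finset.card_le_card_of_injOn (moveIn x) (fun w hw => ?_) fun w hw v hv h => ?_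
    · simp only [A, B, F, G, Finset.coe_filter, Set.mem_ofPred_eq, Finset.mem_univ, true_and,
        Finset.coe_sdiff, Set.mem_sdiff, Finset.mem_coe, Finset.mem_union, Finset.mem_biUnion,
        Finset.mem_filter, not_or, not_exists, not_and] at hw ⊢
      exact ⟨not_single_moveIn hw.1.1 hw.2.1, fun a ha =>
        hw.1.1.moveIn (hw.1.2 a ha) (fun h => hx (h ▸ ha)) (hw.2.2 a ha)⟩
    · simp only [A, Finset.coe_filter, Set.mem_ofPred_eq, Finset.mem_univ, true_and,
        Finset.coe_sdiff, Set.mem_sdiff] at hw hv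
      exact eq_of_moveIn_eq hw.1.1 hv.1.1 h
  have h3 : F.card ≤ fubini (Nat.card S - 1) := by
    have := card_first_le x
    rwa [Nat.card_eq_fintype_card, Fintype.card_subtype] at this
  have h4 : (R.biUnion G).card ≤ R.card * fubini (Nat.card S - 1) :=
    Finset.card_biUnion_le_card_mul _ _ _ fun a _ => by
      have := card_after_le a x
      rwa [Nat.card_eq_fintype_card, Fintype.card_subtype] at this
  have h5 : A.card ≤ B.card + (R.card + 1) * fubini (Nat.card S - 1) := by
    have h6 := Finset.card_union_le F (R.biUnion G)
    have h7 := Finset.le_card_sdiff (F ∪ R.biUnion G) A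
    rw [add_mul, one_mul]
    omega
  have h1' : (B.card : ℝ) ≤ A.card := by exact_mod_cast h1
  have h5' : (A.card : ℝ) ≤ B.card + (R.card + 1) * fubini (Nat.card S - 1) := by exact_mod_cast h5
  rw [hA, hR, abs_le]
  push_cast
  constructor <;> nlinarith [h1', h5']

/-- A given set of `r` elements consists of singleton parts with probability about `2 ^ (-r)`. -/
theorem exists_abs_two_pow_mul_singleCount_sub_le (r : ℕ) : ∃ C : ℝ, 0 ≤ C ∧
    ∀ (S : Type) [Finite S] (R : Finset S), R.card = r →
      |(2 : ℝ) ^ r * singleCount R - fubini (Nat.card S)| ≤ C * fubini (Nat.card S - 1) := by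
  classical
  induction r with
  | zero =>
    refine ⟨0, le_rfl, fun S _ R hR => ?_⟩
    rw [Finset.card_eq_zero.1 hR, singleCount_empty]
    simp
  | succ r ih =>
    obtain ⟨C, hC, h⟩ := ih
    refine ⟨2 ^ r * (r + 1) + C, by positivity, fun S _ R hR => ?_⟩
    obtain ⟨x, R', hx, rfl, hR'⟩ := Finset.card_eq_succ.1 hR
    have h1 := abs_two_mul_singleCount_insert_sub_le hx
    have h2 := h S R' hR'
    rw [hR'] at h1
    calc |(2 : ℝ) ^ (r + 1) * singleCount (insert x R') - fubini (Nat.card S)|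
        = |2 ^ r * (2 * (singleCount (insert x R') : ℝ) - singleCount R') +
            (2 ^ r * (singleCount R' : ℝ) - fubini (Nat.card S))| := by
          congr 1; ring
      _ ≤ 2 ^ r * |2 * (singleCount (insert x R') : ℝ) - singleCount R'| +
            |(2 : ℝ) ^ r * singleCount R' - fubini (Nat.card S)| := by
          refine (abs_add_le _ _).trans (add_le_add_left (le_of_eq ?_) _)
          rw [abs_mul, abs_of_nonneg (by positivity)]
      _ ≤ 2 ^ r * ((r + 1) * fubini (Nat.card S - 1)) + C * fubini (Nat.card S - 1) := by
          gcongr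
      _ = _ := by ring

end WeakOrder

/-! ### Links, and an upper bound for arbitrary tuples of links -/

namespace WeakOrder

section Adj

variable {S : Type*} {w v : WeakOrder S} {a b y : S}

/-- `{a}` and `{b}` are consecutive parts (if `σ` is true), or `a` and `b` are tied (otherwise). -/
def Adj (w : WeakOrder S) (σ : Bool) (a b : S) : Prop :=
  (σ = true → w.Succ a b) ∧ (σ = false → w.Tie a b)

/-- `({a}, {b})`, for `i = (side, a, b)`, is a consecutive embedding in the pair `p`,
left if `side` is true and right otherwise. -/
def Link (p : WeakOrder S × WeakOrder S) (i : Bool × S × S) : Prop :=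
  p.1.Adj i.1 i.2.1 i.2.2 ∧ p.2.Adj (!i.1) i.2.1 i.2.2

theorem Adj.agree {σ : Bool} (hw : w.Adj σ a b) (hv : v.Adj σ a b) (hy : y ≠ b)
    (h : Agree w v a y) : Agree w v b y := by
  cases σ
  · exact (hw.2 rfl).agree (hv.2 rfl) h
  · exact (hw.1 rfl).2.agree (hv.1 rfl).2 hy h

theorem Adj.le {σ : Bool} (h : w.Adj σ a b) : w.le a b := by
  cases σ
  · exact (h.2 rfl).1
  · exact (h.1 rfl).2.le

theorem Succ.not_tie {a' : S} (h : w.Succ a b) (h' : w.Tie a' b) : a' = b :=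
  h.2.single a' h'.2 h'.1

/-- The number of elements strictly below `x`. -/
noncomputable def height (w : WeakOrder S) (x : S) : ℕ := Set.ncard {z | ¬ w.le x z}

theorem height_le [Finite S] (h : w.le a b) : w.height a ≤ w.height b :=
  Set.ncard_le_ncard fun _ hz hb => hz (w.trans _ _ _ h hb)

theorem height_lt [Finite S] (h : w.le a b) (h' : ¬ w.le b a) : w.height a < w.height b :=
  Set.ncard_lt_ncard ⟨fun _ hz hb => hz (w.trans _ _ _ h hb),
    fun hs => hs (show a ∈ {z | ¬ w.le b z} from h') (w.le_refl a)⟩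

/-- Two links ending at `b` on the same side start at the unique preceding singleton. On opposite
sides, `b` would be alone in an order where it is tied with another element. -/
theorem Link.eq_of_eq {p : WeakOrder S × WeakOrder S} {i j : Bool × S × S} (hi : Link p i)
    (hj : Link p j) (h : i.2.2 = j.2.2) : i = j := by
  obtain ⟨σ, a, b⟩ := i
  obtain ⟨τ, c, d⟩ := j
  obtain rfl : b = d := h
  cases σ <;> cases τ
  · obtain rfl : a = c := (hi.2.1 rfl).eq_of_succ (hj.2.1 rfl)
    rfl
  · exact absurd ((hj.1.1 rfl).not_tie (hi.1.2 rfl)) (hi.2.1 rfl).2.1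
  · exact absurd ((hi.1.1 rfl).not_tie (hj.1.2 rfl)) (hj.2.1 rfl).2.1
  · obtain rfl : a = c := (hi.1.1 rfl).eq_of_succ (hj.1.1 rfl)
    rfl

theorem Link.height_lt [Finite S] {p : WeakOrder S × WeakOrder S} {i : Bool × S × S}
    (h : Link p i) : p.1.height i.2.1 + p.2.height i.2.1 < p.1.height i.2.2 + p.2.height i.2.2 := by
  obtain ⟨σ, a, b⟩ := i
  cases σ
  · exact add_lt_add_of_le_of_lt (height_le h.1.le)
      (WeakOrder.height_lt h.2.le (h.2.1 rfl).2.not_le)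
  · exact add_lt_add_of_lt_of_le (WeakOrder.height_lt h.1.le (h.1.1 rfl).2.not_le)
      (height_le h.2.le)

/-- The links may overlap and form chains, but their endpoints are distinct. The sum of the two
heights increases along every link, so it serves as the rank that locates all endpoints in both
orders. -/
theorem card_links_le [Finite S] {J : Type*} [Fintype J] {e : J → Bool × S × S}
    (he : Function.Injective e) :
    Nat.card {p : WeakOrder S × WeakOrder S // ∀ j, Link p (e j)} ≤
      fubini (Nat.card S - Fintype.card J) ^ 2 := by
  classical
  by_cases hne : ∃ p : WeakOrder S × WeakOrder S, ∀ j, Link p (e j)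
  swap
  · have : IsEmpty {p : WeakOrder S × WeakOrder S // ∀ j, Link p (e j)} :=
      ⟨fun p => hne ⟨p.1, p.2⟩⟩
    rw [Nat.card_of_isEmpty]
    exact Nat.zero_le _
  obtain ⟨p, hp⟩ := hne
  have hinj : Function.Injective fun j => (e j).2.2 := fun i j hij =>
    he ((hp i).eq_of_eq (hp j) hij)
  let D : Finset S := Finset.univ.image fun j => (e j).2.2
  have hD : D.card = Fintype.card J := Finset.card_image_of_injective _ hinj
  rw [sq, ← hD]
  refine card_pair_le_of_located D D fun p q hp hq => ?_
  constructor <;>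
    refine ⟨fun x => p.1.height x + p.2.height x, fun b hb y hy hr => ?_⟩ <;>
    obtain ⟨j, -, rfl⟩ := Finset.mem_image.1 hb
  · exact (hp j).1.agree (hq j).1 hy (hr _ (hp j).height_lt)
  · exact (hp j).2.agree (hq j).2 hy (hr _ (hp j).height_lt)

end Adj

/-! ### Counting pairs with given disjoint links -/

section Disjoint

variable {S J : Type*} {σ : J → Bool} {a b : J → S}

open Classical in
/-- Send each `b j` to `a j` and fix everything else. -/
noncomputable def retract (a b : J → S) (x : S) : S :=
  if h : ∃ j, x = b j then a h.choose else x

theorem retract_apply (hb : Function.Injective b) (j : J) : retract a b (b j) = a j := by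
  have h : ∃ i, b j = b i := ⟨j, rfl⟩
  rw [retract, dif_pos h, ← hb h.choose_spec]

theorem retract_of_forall_ne {x : S} (h : ∀ j, x ≠ b j) : retract a b x = x :=
  dif_neg fun ⟨j, hj⟩ => h j hj

theorem retract_eq_iff (ha : Function.Injective a) (hb : Function.Injective b)
    (hab : ∀ i j, a i ≠ b j) {x : S} {j : J} : retract a b x = a j ↔ x = a j ∨ x = b j := by
  by_cases h : ∃ i, x = b i
  · obtain ⟨i, rfl⟩ := h
    rw [retract_apply hb, ha.eq_iff, hb.eq_iff]
    exact ⟨Or.inr, fun h => h.resolve_left (hab j i).symm⟩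
  · push Not at h
    rw [retract_of_forall_ne h]
    exact ⟨Or.inl, fun h' => h'.resolve_right (h j)⟩

/-- Where the part of `a j` is `{a j, b j}` and `σ j` is true, split it into `{a j}, {b j}`. -/
def splitAdj (w : WeakOrder S) (σ : J → Bool) (a b : J → S) (hab : ∀ i j, a i ≠ b j)
    (htie : ∀ j, w.Tie (a j) (b j))
    (hpart : ∀ j, σ j = true → ∀ x, w.Tie (a j) x → x = a j ∨ x = b j) : WeakOrder S where
  le x y := w.le x y ∧ ∀ j, σ j = true → x = b j → y ≠ a j
  trans x y z := by
    rintro ⟨h1, h2⟩ ⟨h3, h4⟩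
    refine ⟨w.trans _ _ _ h1 h3, fun j hj hx hz => ?_⟩
    subst hx hz
    rcases hpart j hj y ⟨w.trans _ _ _ (htie j).1 h1, h3⟩ with h | h
    · exact h2 j hj rfl h
    · exact h4 j hj h rfl
  total x y := by
    have key : ∀ x y, w.le x y → (w.le x y ∧ ∀ j, σ j = true → x = b j → y ≠ a j) ∨
        (w.le y x ∧ ∀ j, σ j = true → y = b j → x ≠ a j) := by
      intro x y h
      by_cases hxy : ∃ j, x = b j ∧ y = a j
      · obtain ⟨j, rfl, rfl⟩ := hxy
        exact Or.inr ⟨(htie j).1, fun i _ hi => absurd hi (hab j i)⟩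
      · exact Or.inl ⟨h, fun j _ hx hy => hxy ⟨j, hx, hy⟩⟩
    exact (w.total x y).elim (key x y) fun h => (key y x h).symm

theorem adj_splitAdj (w : WeakOrder S) (ha : Function.Injective a) (hb : Function.Injective b)
    (hab : ∀ i j, a i ≠ b j) (htie : ∀ j, w.Tie (a j) (b j))
    (hpart : ∀ j, σ j = true → ∀ x, w.Tie (a j) x → x = a j ∨ x = b j) (j : J) :
    (w.splitAdj σ a b hab htie hpart).Adj (σ j) (a j) (b j) := by
  have hle : ∀ y, w.le y (b j) ↔ (w.splitAdj σ a b hab htie hpart).le y (b j) := fun y =>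
    ⟨fun h => ⟨h, fun i _ _ => (hab i j).symm⟩, And.left⟩
  constructor
  · intro hj
    have h1 : ∀ y, y ≠ b j → (w.le y (a j) ↔ (w.splitAdj σ a b hab htie hpart).le y (a j)) :=
      fun y hy => ⟨fun h => ⟨h, fun i _ h2 h3 => hy (by rw [h2, ha h3])⟩, And.left⟩
    refine ⟨fun y h h' => ?_, hab j j, fun y hy => ⟨?_, ?_⟩⟩
    · exact (hpart j hj y ⟨h.1, h'.1⟩).resolve_right fun hy => h'.2 j hj hy rfl
    · rw [← h1 y hy]
      constructor
      · rintro ⟨h2, h3⟩ h4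
        exact (hpart j hj y ⟨w.trans _ _ _ (htie j).1 h2, h4⟩).elim (h3 j hj rfl) hy
      · intro h
        refine ⟨w.trans _ _ _ (htie j).2 ((w.total _ _).resolve_right h), fun i _ hi hyi => h ?_⟩
        rw [hyi, hb hi]
        exact w.le_refl _
    · rw [← h1 y hy, ← hle y, (htie j).le_right_iff]
  · intro hj
    refine ⟨(hle _).1 (htie j).1, (htie j).2, fun i hi h => ?_⟩
    rw [hb h, hi] at hj
    exact absurd hj (by simp)

open Classical in
/-- The weak orders in which the `b j` are adjacent to the `a j` as prescribed by `σ` are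
given by their restrictions to the complement of the `b j`. -/
theorem card_adj_eq [Finite S] [Fintype J] (ha : Function.Injective a)
    (hb : Function.Injective b) (hab : ∀ i j, a i ≠ b j) :
    ∃ R : Finset {x // x ∉ Finset.univ.image b}, R.card = ({j | σ j = true} : Finset J).card ∧
      Nat.card {w : WeakOrder S // ∀ j, w.Adj (σ j) (a j) (b j)} = singleCount R := by
  set D : Finset S := Finset.univ.image b with hD
  have hbD : ∀ j, b j ∈ D := fun j => Finset.mem_image_of_mem b (Finset.mem_univ j)
  have haD : ∀ j, a j ∉ D := fun j h => by
    obtain ⟨i, -, hi⟩ := Finset.mem_image.1 h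
    exact hab j i hi.symm
  have hρ : ∀ x, retract a b x ∉ D := by
    intro x
    by_cases h : ∃ j, x = b j
    · obtain ⟨j, rfl⟩ := h
      rw [retract_apply hb]
      exact haD j
    · push Not at h
      rw [retract_of_forall_ne h]
      intro hx
      obtain ⟨i, -, hi⟩ := Finset.mem_image.1 hx
      exact h i hi.symm
  refine ⟨({j | σ j = true} : Finset J).image fun j => ⟨a j, haD j⟩,
    Finset.card_image_of_injective _ fun i j h => ha (Subtype.ext_iff.1 h), ?_⟩
  refine Nat.card_congr (Equiv.ofBijective
    (fun w => ⟨comap (fun x : {x // x ∉ D} => x.1) w.1, ?_⟩) ⟨fun w v hwv => ?_, fun v => ?_⟩)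
  · intro x hx y h1 h2
    obtain ⟨j, hj, rfl⟩ := Finset.mem_image.1 hx
    exact Subtype.ext (((w.2 j).1 (Finset.mem_filter.1 hj).2).1 y.1 h1 h2)
  · refine Subtype.ext (Located.eq_of_comap_eq (D := D) ?_ (Subtype.ext_iff.1 hwv))
    refine located_of_star fun x hx => ?_
    obtain ⟨j, -, rfl⟩ := Finset.mem_image.1 hx
    refine Or.inl ⟨a j, haD j, ?_⟩
    cases hj : σ j
    · exact Or.inl ⟨(w.2 j).2 hj, (v.2 j).2 hj⟩
    · exact Or.inr (Or.inl ⟨((w.2 j).1 hj).2, ((v.2 j).1 hj).2⟩)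
  · let u : WeakOrder S := comap (fun x => (⟨retract a b x, hρ x⟩ : {x // x ∉ D})) v.1
    have hra : ∀ j, retract a b (a j) = a j := fun j => retract_of_forall_ne (hab j)
    have htie : ∀ j, u.Tie (a j) (b j) := by
      intro j
      simp only [u, Tie, comap, retract_apply hb, hra]
      exact ⟨v.1.le_refl _, v.1.le_refl _⟩
    have hpart : ∀ j, σ j = true → ∀ x, u.Tie (a j) x → x = a j ∨ x = b j := by
      intro j hj x hx
      simp only [u, Tie, comap, hra] at hx
      have h := v.2 ⟨a j, haD j⟩ (Finset.mem_image_of_mem _ (by simp [hj])) _ hx.1 hx.2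
      exact (retract_eq_iff ha hb hab).1 (Subtype.ext_iff.1 h)
    refine ⟨⟨u.splitAdj σ a b hab htie hpart, adj_splitAdj u ha hb hab htie hpart⟩, ?_⟩
    apply Subtype.ext
    ext ⟨x, hx⟩ ⟨y, hy⟩
    have hx' : ∀ j, x ≠ b j := fun j h => hx (h ▸ hbD j)
    have hy' : ∀ j, y ≠ b j := fun j h => hy (h ▸ hbD j)
    simp [splitAdj, comap, u, retract_of_forall_ne hx', retract_of_forall_ne hy', hx']

end Disjoint

/-- The number of pairs with `k` given disjoint links. -/
theorem exists_card_disjoint_links (k : ℕ) : ∃ C : ℝ, 0 ≤ C ∧ ∀ (S : Type) [Finite S]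
    (σ : Fin k → Bool) (a b : Fin k → S), Function.Injective a → Function.Injective b →
      (∀ i j, a i ≠ b j) → ∃ x y : ℝ,
        |x - fubini (Nat.card S - k)| ≤ C * fubini (Nat.card S - k - 1) ∧
        |y - fubini (Nat.card S - k)| ≤ C * fubini (Nat.card S - k - 1) ∧
        (2 : ℝ) ^ k * Nat.card {p : WeakOrder S × WeakOrder S //
          ∀ j, Link p (σ j, a j, b j)} = x * y := by
  classical
  choose C hC h using exists_abs_two_pow_mul_singleCount_sub_le
  refine ⟨∑ r ∈ Finset.range (k + 1), C r, Finset.sum_nonneg fun r _ => hC r,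
    fun S _ σ a b ha hb hab => ?_⟩
  have hle : ∀ r ≤ k, C r ≤ ∑ r ∈ Finset.range (k + 1), C r := fun r hr =>
    Finset.single_le_sum (fun r _ => hC r) (Finset.mem_range.2 (Nat.lt_succ_of_le hr))
  have hcard : Nat.card {x // x ∉ Finset.univ.image b} = Nat.card S - k := by
    have := Fintype.ofFinite S
    rw [Nat.card_eq_fintype_card, Fintype.card_subtype_compl, Nat.card_eq_fintype_card,
      Fintype.card_coe, Finset.card_image_of_injective _ hb, Finset.card_univ, Fintype.card_fin]
  have key : ∀ τ : Fin k → Bool,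
      |(2 : ℝ) ^ ({j | τ j = true} : Finset (Fin k)).card *
        Nat.card {w : WeakOrder S // ∀ j, w.Adj (τ j) (a j) (b j)} - fubini (Nat.card S - k)| ≤
      (∑ r ∈ Finset.range (k + 1), C r) * fubini (Nat.card S - k - 1) := by
    intro τ
    obtain ⟨R, hR, hw⟩ := card_adj_eq (σ := τ) ha hb hab
    have h1 := h _ _ R hR
    rw [hcard, ← hw] at h1
    refine h1.trans (mul_le_mul_of_nonneg_right (hle _ ?_) (Nat.cast_nonneg _))
    simpa using Finset.card_le_univ ({j | τ j = true} : Finset (Fin k))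
  -- The conditions on the two orders are independent. Each link asks for a singleton in exactly one
  -- of them, so the two powers of 2 multiply to `2 ^ k`.
  refine ⟨_, _, key σ, key fun j => !σ j, ?_⟩
  have h1 : Nat.card {p : WeakOrder S × WeakOrder S // ∀ j, Link p (σ j, a j, b j)} =
      Nat.card {w : WeakOrder S // ∀ j, w.Adj (σ j) (a j) (b j)} *
        Nat.card {w : WeakOrder S // ∀ j, w.Adj (!σ j) (a j) (b j)} := by
    rw [← Nat.card_prod]
    refine Nat.card_congr ((Equiv.subtypeEquivRight fun p => ?_).trans
      (Equiv.subtypeProdEquivProd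
        (p := fun w : WeakOrder S => ∀ j, w.Adj (σ j) (a j) (b j))
        (q := fun w : WeakOrder S => ∀ j, w.Adj (!σ j) (a j) (b j))))
    exact forall_and
  have h2 : ({j | σ j = true} : Finset (Fin k)).card +
      ({j | (!σ j) = true} : Finset (Fin k)).card = k := by
    have := Finset.card_filter_add_card_filter_not (s := (Finset.univ : Finset (Fin k)))
      (fun j => σ j = true)
    simpa using this
  rw [h1]
  push_cast
  have h3 : (2 : ℝ) ^ k = 2 ^ ({j | σ j = true} : Finset (Fin k)).card *
      2 ^ ({j | (!σ j) = true} : Finset (Fin k)).card := by rw [← pow_add, h2]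
  rw [h3]
  ring

end WeakOrder

/-! ### Embeddings involving a non-singleton part are negligible -/

theorem Nat.card_exists_le {α Q : Type*} [Finite α] [Finite Q] {P : Q → α → Prop} {M : ℕ}
    (h : ∀ q, Nat.card {x // P q x} ≤ M) : Nat.card {x // ∃ q, P q x} ≤ Nat.card Q * M := by
  classical
  have := Fintype.ofFinite α
  have := Fintype.ofFinite Q
  have h1 : ({x | ∃ q, P q x} : Finset α) = Finset.univ.biUnion fun q => {x | P q x} := by
    ext x; simp
  rw [Nat.card_eq_fintype_card, Fintype.card_subtype, h1, Nat.card_eq_fintype_card,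
    ← Finset.card_univ]
  refine Finset.card_biUnion_le_card_mul _ _ _ fun q _ => ?_
  rw [← Fintype.card_subtype, ← Nat.card_eq_fintype_card]
  exact h q

theorem Nat.card_or_le {α : Type*} [Finite α] (P Q : α → Prop) :
    Nat.card {x // P x ∨ Q x} ≤ Nat.card {x // P x} + Nat.card {x // Q x} := by
  classical
  have := Fintype.ofFinite α
  simp only [Nat.card_eq_fintype_card, Fintype.card_subtype, Finset.filter_or]
  exact Finset.card_union_le _ _

namespace WeakOrder

variable {S : Type*}

/-- Two parts of `p.1`, of at least two elements each, lie in a part of `p.2`. -/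
def TwoLarge (p : WeakOrder S × WeakOrder S) (i : S × S × S × S) : Prop :=
  i.1 ≠ i.2.1 ∧ i.2.2.1 ≠ i.2.2.2 ∧ ¬ p.1.Tie i.1 i.2.2.1 ∧ p.1.Tie i.1 i.2.1 ∧
    p.1.Tie i.2.2.1 i.2.2.2 ∧
    p.2.Tie i.1 i.2.1 ∧ p.2.Tie i.1 i.2.2.1 ∧ p.2.Tie i.1 i.2.2.2

/-- A part of at least two elements followed by a singleton part, all in a part of `p.2`. -/
def LargeSmall (p : WeakOrder S × WeakOrder S) (i : S × S × S) : Prop :=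
  i.1 ≠ i.2.1 ∧ p.1.Tie i.1 i.2.1 ∧ p.1.After i.1 i.2.2 ∧ p.2.Tie i.1 i.2.1 ∧ p.2.Tie i.1 i.2.2

/-- A part of at least two elements preceded by a singleton part, all in a part of `p.2`. -/
def SmallLarge (p : WeakOrder S × WeakOrder S) (i : S × S × S) : Prop :=
  i.1 ≠ i.2.1 ∧ p.1.Tie i.1 i.2.1 ∧ p.1.Before i.1 i.2.2 ∧ p.2.Tie i.1 i.2.1 ∧ p.2.Tie i.1 i.2.2

/-- A witness for a left consecutive embedding of parts that are not both singletons. -/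
def HasLargeEmbedding (p : WeakOrder S × WeakOrder S) : Prop :=
  (∃ i, TwoLarge p i) ∨ (∃ i, LargeSmall p i) ∨ ∃ i, SmallLarge p i

/-- In the first order `a'` and `b'` are located by `a` and `b`; in the second, `a'`, `b` and `b'`
are all located by `a`. The five lost elements outweigh the $n^4$ choices of the witness. -/
theorem card_twoLarge_le [Finite S] (i : S × S × S × S) :
    Nat.card {p : WeakOrder S × WeakOrder S // TwoLarge p i} ≤
      fubini (Nat.card S - 2) * fubini (Nat.card S - 3) := by
  classical
  obtain ⟨a, a', b, b'⟩ := i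
  -- If no pair qualifies the count is 0; otherwise any qualifying pair shows that the four elements
  -- are distinct.
  by_cases hne : ∃ p : WeakOrder S × WeakOrder S, TwoLarge p (a, a', b, b')
  swap
  · have : IsEmpty {p : WeakOrder S × WeakOrder S // TwoLarge p (a, a', b, b')} :=
      ⟨fun p => hne ⟨p.1, p.2⟩⟩
    rw [Nat.card_of_isEmpty]
    exact Nat.zero_le _
  obtain ⟨p, h1, h2, h3, h4, h5, -⟩ := hne
  simp only at h1 h2 h3 h4 h5
  have hab : a ≠ b := fun h => h3 (h ▸ ⟨p.1.le_refl _, p.1.le_refl _⟩)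
  have hab' : a ≠ b' := fun h => h3 (h ▸ h5.symm)
  have ha'b : a' ≠ b := fun h => h3 (h ▸ h4)
  have ha'b' : a' ≠ b' := fun h => h3 (h4.trans (h ▸ h5.symm))
  have hD : ({a', b'} : Finset S).card = 2 := Finset.card_pair ha'b'
  have hE : ({a', b, b'} : Finset S).card = 3 :=
    Finset.card_eq_three.2 ⟨_, _, _, ha'b, ha'b', h2, rfl⟩
  rw [← hD, ← hE]
  refine card_pair_le_of_located _ _ fun p q hp hq => ⟨located_of_star ?_, located_of_star ?_⟩
  · intro x hx
    rw [Finset.mem_insert, Finset.mem_singleton] at hx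
    rcases hx with rfl | rfl
    · exact Or.inl ⟨a, by simp [h1, hab'], Or.inl ⟨hp.2.2.2.1, hq.2.2.2.1⟩⟩
    · exact Or.inl ⟨b, by simp [h2, ha'b.symm], Or.inl ⟨hp.2.2.2.2.1, hq.2.2.2.2.1⟩⟩
  · have ha : a ∉ ({a', b, b'} : Finset S) := by simp [h1, hab, hab']
    intro x hx
    simp only [Finset.mem_insert, Finset.mem_singleton] at hx
    refine Or.inl ⟨a, ha, Or.inl ?_⟩
    rcases hx with rfl | rfl | rfl
    · exact ⟨hp.2.2.2.2.2.1, hq.2.2.2.2.2.1⟩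
    · exact ⟨hp.2.2.2.2.2.2.1, hq.2.2.2.2.2.2.1⟩
    · exact ⟨hp.2.2.2.2.2.2.2, hq.2.2.2.2.2.2.2⟩

/-- Both orders lose `a'` and `b`, four elements in all against $n^3$ choices of the witness. -/
theorem card_largeSmall_le [Finite S] (i : S × S × S) :
    Nat.card {p : WeakOrder S × WeakOrder S // LargeSmall p i} ≤
      fubini (Nat.card S - 2) * fubini (Nat.card S - 2) := by
  classical
  obtain ⟨a, a', b⟩ := i
  by_cases hne : ∃ p : WeakOrder S × WeakOrder S, LargeSmall p (a, a', b)
  swap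
  · have : IsEmpty {p : WeakOrder S × WeakOrder S // LargeSmall p (a, a', b)} :=
      ⟨fun p => hne ⟨p.1, p.2⟩⟩
    rw [Nat.card_of_isEmpty]
    exact Nat.zero_le _
  obtain ⟨p, h1, h2, h3, -⟩ := hne
  simp only at h1 h2 h3
  have hab : a ≠ b := h3.1
  have ha'b : a' ≠ b := fun h => h3.not_le (h ▸ h2.2)
  have hD : ({a', b} : Finset S).card = 2 := Finset.card_pair ha'b
  have ha : a ∉ ({a', b} : Finset S) := by simp [h1, hab]
  rw [← hD]
  refine card_pair_le_of_located _ _ fun p q hp hq =>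
    ⟨located_of_star fun x hx => Or.inl ⟨a, ha, ?_⟩, located_of_star fun x hx => Or.inl ⟨a, ha, ?_⟩⟩
    <;> rw [Finset.mem_insert, Finset.mem_singleton] at hx <;> rcases hx with rfl | rfl
  · exact Or.inl ⟨hp.2.1, hq.2.1⟩
  · exact Or.inr (Or.inl ⟨hp.2.2.1, hq.2.2.1⟩)
  · exact Or.inl ⟨hp.2.2.2.1, hq.2.2.2.1⟩
  · exact Or.inl ⟨hp.2.2.2.2, hq.2.2.2.2⟩

theorem card_smallLarge_le [Finite S] (i : S × S × S) :
    Nat.card {p : WeakOrder S × WeakOrder S // SmallLarge p i} ≤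
      fubini (Nat.card S - 2) * fubini (Nat.card S - 2) := by
  classical
  obtain ⟨a, a', b⟩ := i
  by_cases hne : ∃ p : WeakOrder S × WeakOrder S, SmallLarge p (a, a', b)
  swap
  · have : IsEmpty {p : WeakOrder S × WeakOrder S // SmallLarge p (a, a', b)} :=
      ⟨fun p => hne ⟨p.1, p.2⟩⟩
    rw [Nat.card_of_isEmpty]
    exact Nat.zero_le _
  obtain ⟨p, h1, h2, h3, -⟩ := hne
  simp only at h1 h2 h3
  have hab : a ≠ b := h3.1
  have ha'b : a' ≠ b := fun h =>
    ((h3.2 a hab).1).1 (h ▸ h2.1) (p.1.le_refl a)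
  have hD : ({a', b} : Finset S).card = 2 := Finset.card_pair ha'b
  have ha : a ∉ ({a', b} : Finset S) := by simp [h1, hab]
  rw [← hD]
  refine card_pair_le_of_located _ _ fun p q hp hq =>
    ⟨located_of_star fun x hx => Or.inl ⟨a, ha, ?_⟩, located_of_star fun x hx => Or.inl ⟨a, ha, ?_⟩⟩
    <;> rw [Finset.mem_insert, Finset.mem_singleton] at hx <;> rcases hx with rfl | rfl
  · exact Or.inl ⟨hp.2.1, hq.2.1⟩
  · exact Or.inr (Or.inr ⟨hp.2.2.1, hq.2.2.1⟩)
  · exact Or.inl ⟨hp.2.2.2.1, hq.2.2.2.1⟩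
  · exact Or.inl ⟨hp.2.2.2.2, hq.2.2.2.2⟩

theorem card_hasLargeEmbedding_le [Finite S] :
    Nat.card {p : WeakOrder S × WeakOrder S // HasLargeEmbedding p} ≤
      Nat.card S ^ 4 * (fubini (Nat.card S - 2) * fubini (Nat.card S - 3)) +
        2 * (Nat.card S ^ 3 * (fubini (Nat.card S - 2) * fubini (Nat.card S - 2))) := by
  have h4 := Nat.card_exists_le (card_twoLarge_le (S := S))
  have h3 := Nat.card_exists_le (card_largeSmall_le (S := S))
  have h3' := Nat.card_exists_le (card_smallLarge_le (S := S))
  simp only [Nat.card_prod] at h4 h3 h3'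
  refine (Nat.card_or_le _ _).trans ?_
  refine (add_le_add h4 ((Nat.card_or_le _ _).trans (add_le_add h3 h3'))).trans (le_of_eq ?_)
  ring

theorem tieClass_eq_singleton {w : WeakOrder S} {a : S} (h : w.Single a) : w.tieClass a = {a} := by
  ext y
  exact ⟨fun hy => h y hy.1 hy.2, fun hy => by
    rw [Set.mem_singleton_iff.1 hy]; exact ⟨w.le_refl a, w.le_refl a⟩⟩

theorem isEmbedding_of_succ {w v : WeakOrder S} {a b : S} (h : w.Succ a b) (h' : v.Tie a b) :
    IsEmbedding w v {a} {b} := by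
  refine ⟨⟨⟨a, tieClass_eq_singleton h.1⟩, ⟨b, tieClass_eq_singleton h.2.single⟩, ?_, ?_⟩,
    v.tieClass a, ⟨a, rfl⟩, ?_⟩
  · rintro x rfl y rfl
    exact h.2.not_le
  · rintro ⟨_, ⟨c, rfl⟩, h1, h2⟩
    have hc : c ∈ w.tieClass c := ⟨w.le_refl c, w.le_refl c⟩
    have h3 := h1 a rfl c hc
    have h4 := h2 c hc b rfl
    by_cases hcb : c = b
    · exact h4 (hcb ▸ w.le_refl c)
    · exact h4 (((h.2.2 c hcb).1).2 h3)
  · rintro x (rfl | rfl)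
    · exact ⟨v.le_refl x, v.le_refl x⟩
    · exact h'

/-- If both parts are singletons they form a link. Otherwise a second element chosen from each
larger part gives one of the three witnesses; since no part lies in between, a singleton part is
placed exactly by its neighbour. -/
theorem IsEmbedding.succ_or {w v : WeakOrder S} {A B : Set S} (h : IsEmbedding w v A B) :
    (∃ a b, w.Succ a b ∧ v.Tie a b) ∨ HasLargeEmbedding (w, v) := by
  obtain ⟨⟨⟨a, rfl⟩, ⟨b, rfl⟩, hlt, hC⟩, _, ⟨t, rfl⟩, hT⟩ := h
  have ha : a ∈ w.tieClass a := ⟨w.le_refl a, w.le_refl a⟩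
  have hb : b ∈ w.tieClass b := ⟨w.le_refl b, w.le_refl b⟩
  have hba : ¬ w.le b a := hlt a ha b hb
  have hab : w.le a b := (w.total a b).resolve_right hba
  have hne : a ≠ b := fun h => hba (h ▸ w.le_refl a)
  have htie : ∀ x y, x ∈ w.tieClass a ∪ w.tieClass b → y ∈ w.tieClass a ∪ w.tieClass b →
      v.Tie x y := fun x y hx hy => (Tie.symm (hT hx)).trans (hT hy)
  have hbetween : ∀ y, w.le y a ∨ w.le b y := by
    intro y
    by_contra! hy
    refine hC ⟨w.tieClass y, ⟨y, rfl⟩, fun x hx z hz h => hy.1 ?_, fun z hz x hx h => hy.2 ?_⟩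
    · exact w.trans _ _ _ hz.1 (w.trans _ _ _ h hx.2)
    · exact w.trans _ _ _ hx.1 (w.trans _ _ _ h hz.2)
  have hafter : w.Single b → w.After a b := fun hs => ⟨hne, fun y hy =>
    ⟨⟨fun h1 h2 => hba (w.trans _ _ _ h1 h2), fun h => (hbetween y).resolve_left h⟩,
      ⟨fun h => (hbetween y).resolve_right fun h' => hy (hs y h' h),
        fun h => w.trans _ _ _ h hab⟩⟩⟩
  have hbefore : w.Single a → w.Before b a := fun hs => ⟨hne.symm, fun y hy =>
    ⟨⟨fun h1 h2 => hba (w.trans _ _ _ h2 h1), fun h => (hbetween y).resolve_right h⟩,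
      ⟨fun h => (hbetween y).resolve_left fun h' => hy (hs y h h'),
        fun h => w.trans _ _ _ hab h⟩⟩⟩
  by_cases hsa : w.Single a <;> by_cases hsb : w.Single b
  · exact Or.inl ⟨a, b, ⟨hsa, hafter hsb⟩, htie a b (Or.inl ha) (Or.inr hb)⟩
  · obtain ⟨b', hb', hbb'⟩ := not_single_iff.1 hsb
    exact Or.inr (Or.inr (Or.inr ⟨(b, b', a), hb'.symm, hbb', hbefore hsa,
      htie b b' (Or.inr hb) (Or.inr hbb'), htie b a (Or.inr hb) (Or.inl ha)⟩))
  · obtain ⟨a', ha', haa'⟩ := not_single_iff.1 hsa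
    exact Or.inr (Or.inr (Or.inl ⟨(a, a', b), ha'.symm, haa', hafter hsb,
      htie a a' (Or.inl ha) (Or.inl haa'), htie a b (Or.inl ha) (Or.inr hb)⟩))
  · obtain ⟨a', ha', haa'⟩ := not_single_iff.1 hsa
    obtain ⟨b', hb', hbb'⟩ := not_single_iff.1 hsb
    exact Or.inr (Or.inl ⟨(a, a', b, b'), ha'.symm, hb'.symm, fun h => hba h.2, haa', hbb',
      htie a a' (Or.inl ha) (Or.inl haa'), htie a b (Or.inl ha) (Or.inr hb),
      htie a b' (Or.inl ha) (Or.inr hbb')⟩)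

theorem NoConsecutiveEmbedding.not_link {p : WeakOrder S × WeakOrder S}
    (h : NoConsecutiveEmbedding p) (i : Bool × S × S) : ¬ Link p i := by
  obtain ⟨σ, a, b⟩ := i
  intro hi
  cases σ
  · exact (h {a} {b}).2 (isEmbedding_of_succ (hi.2.1 rfl) (hi.1.2 rfl))
  · exact (h {a} {b}).1 (isEmbedding_of_succ (hi.1.1 rfl) (hi.2.2 rfl))

theorem noConsecutiveEmbedding_or {p : WeakOrder S × WeakOrder S} (h : ∀ i, ¬ Link p i) :
    NoConsecutiveEmbedding p ∨ HasLargeEmbedding p ∨ HasLargeEmbedding p.swap := by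
  by_contra! hcon
  refine hcon.1 fun A B => ⟨fun hl => ?_, fun hr => ?_⟩
  · rcases hl.succ_or with ⟨a, b, h1, h2⟩ | h1
    · exact h (true, a, b) ⟨⟨fun _ => h1, by simp⟩, ⟨by simp, fun _ => h2⟩⟩
    · exact hcon.2.1 h1
  · rcases hr.succ_or with ⟨a, b, h1, h2⟩ | h1
    · exact h (false, a, b) ⟨⟨by simp, fun _ => h2⟩, ⟨fun _ => h1, by simp⟩⟩
    · exact hcon.2.2 h1

end WeakOrder

open WeakOrder in
theorem embeddingFreePairCount_le (n : ℕ) : embeddingFreePairCount n ≤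
    Nat.card {p : WeakOrder (Fin n) × WeakOrder (Fin n) // ∀ i, ¬ Link p i} :=
  Nat.card_le_card_of_injective (Subtype.impEmbedding _ _ fun _ h => h.not_link)
    (Function.Embedding.injective _)

open WeakOrder in
theorem card_no_link_le (n : ℕ) :
    Nat.card {p : WeakOrder (Fin n) × WeakOrder (Fin n) // ∀ i, ¬ Link p i} ≤
      embeddingFreePairCount n + 2 * (n ^ 4 * (fubini (n - 2) * fubini (n - 3)) +
        2 * (n ^ 3 * (fubini (n - 2) * fubini (n - 2)))) := by
  have h1 := card_hasLargeEmbedding_le (S := Fin n)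
  have h2 : Nat.card {p : WeakOrder (Fin n) × WeakOrder (Fin n) // HasLargeEmbedding p.swap} =
      Nat.card {p : WeakOrder (Fin n) × WeakOrder (Fin n) // HasLargeEmbedding p} :=
    Nat.card_congr ((Equiv.prodComm _ _).subtypeEquiv fun p => Iff.rfl)
  rw [Nat.card_eq_fintype_card (α := Fin n), Fintype.card_fin] at h1
  have h3 : Nat.card {p : WeakOrder (Fin n) × WeakOrder (Fin n) // ∀ i, ¬ Link p i} ≤
      Nat.card {p : WeakOrder (Fin n) × WeakOrder (Fin n) // NoConsecutiveEmbedding p ∨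
        HasLargeEmbedding p ∨ HasLargeEmbedding p.swap} :=
    Nat.card_le_card_of_injective (Subtype.impEmbedding _ _ fun _ h => noConsecutiveEmbedding_or h)
      (Function.Embedding.injective _)
  have h4 := Nat.card_or_le
    (NoConsecutiveEmbedding (S := Fin n)) (fun p => HasLargeEmbedding p ∨ HasLargeEmbedding p.swap)
  have h5 := Nat.card_or_le (HasLargeEmbedding (S := Fin n)) (fun p => HasLargeEmbedding p.swap)
  rw [embeddingFreePairCount]
  omega

/-! ### Factorial moments and Poisson convergence -/

section

open Filter Finset

/-- The Bonferroni inequalities, pointwise. -/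
theorem abs_ite_sub_sum_choose_le (X K : ℕ) :
    |(if X = 0 then 1 else 0 : ℝ) - ∑ k ∈ range (K + 1), (-1) ^ k * (X.choose k : ℝ)| ≤
      X.choose (K + 1) := by
  cases X with
  | zero =>
    have : ∑ k ∈ range (K + 1), (-1) ^ k * ((0 : ℕ).choose k : ℝ) = 1 := by
      rw [sum_range_succ']; simp
    rw [if_pos rfl, this, sub_self, abs_zero]
    positivity
  | succ m =>
    -- For `X = m + 1` the truncated alternating sum equals $(-1)^K\binom mK$, which Pascal's rule
    -- bounds by $\binom{m+1}{K+1}$.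
    have h := congrArg (Int.cast (R := ℝ))
      (Int.alternating_sum_range_choose_eq_choose (n := m) (m := K))
    push_cast at h
    rw [if_neg (Nat.succ_ne_zero m), zero_sub, abs_neg, h, abs_mul, abs_pow, abs_neg, abs_one,
      one_pow, one_mul, Nat.abs_cast, Nat.choose_succ_succ]
    push_cast
    linarith [Nat.cast_nonneg (α := ℝ) (m.choose (K + 1))]

/-- If the factorial moments of counting variables on uniform finite probability spaces converge
to those of a Poisson variable, then the probability of `0` converges to that of the Poisson
variable. -/
theorem tendsto_card_eq_zero_of_tendsto_descFactorial {Ω : ℕ → Type*} [∀ n, Fintype (Ω n)]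
    [∀ n, Nonempty (Ω n)] (X : ∀ n, Ω n → ℕ) (c : ℝ)
    (h : ∀ k, Tendsto (fun n => (∑ ω, ((X n ω).descFactorial k : ℝ)) / Fintype.card (Ω n)) atTop
      (𝓝 (c ^ k))) :
    Tendsto (fun n => (#{ω | X n ω = 0} : ℝ) / Fintype.card (Ω n)) atTop
      (𝓝 (Real.exp (-c))) := by
  let β : ℕ → ℕ → ℝ := fun k n => (∑ ω, ((X n ω).choose k : ℝ)) / Fintype.card (Ω n)
  have hβ : ∀ k, Tendsto (β k) atTop (𝓝 (c ^ k / k !)) := by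
    intro k
    refine ((h k).div_const (k ! : ℝ)).congr fun n => ?_
    simp only [β]
    rw [div_right_comm, sum_div]
    congr 1
    refine sum_congr rfl fun ω _ => ?_
    rw [Nat.descFactorial_eq_factorial_mul_choose, Nat.cast_mul,
      mul_div_cancel_left₀ _ (by positivity)]
  have hbound : ∀ K n, |(#{ω | X n ω = 0} : ℝ) / Fintype.card (Ω n) -
      ∑ k ∈ range (K + 1), (-1) ^ k * β k n| ≤ β (K + 1) n := by
    intro K n
    have hN : (0 : ℝ) < Fintype.card (Ω n) := by exact_mod_cast Fintype.card_pos
    have h1 : (#{ω | X n ω = 0} : ℝ) = ∑ ω, if X n ω = 0 then 1 else 0 := by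
      rw [card_filter]; push_cast; rfl
    have h2 : ∑ k ∈ range (K + 1), (-1) ^ k * β k n =
        (∑ ω, ∑ k ∈ range (K + 1), (-1) ^ k * ((X n ω).choose k : ℝ)) / Fintype.card (Ω n) := by
      rw [sum_comm, sum_div]
      refine sum_congr rfl fun k _ => ?_
      rw [← mul_sum, mul_div_assoc]
    rw [h1, h2, ← sub_div, ← sum_sub_distrib, abs_div, abs_of_pos hN]
    refine div_le_div_of_nonneg_right ((abs_sum_le_sum_abs _ _).trans ?_) hN.le
    exact sum_le_sum fun ω _ => abs_ite_sub_sum_choose_le _ _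
  rw [Metric.tendsto_atTop]
  intro ε hε
  have hexp : Tendsto (fun K => ∑ k ∈ range (K + 1), (-c) ^ k / (k ! : ℝ)) atTop
      (𝓝 (Real.exp (-c))) := by
    have := NormedSpace.expSeries_div_hasSum_exp (-c)
    rw [← Real.exp_eq_exp_ℝ] at this
    exact (tendsto_add_atTop_iff_nat 1).2 this.tendsto_sum_nat
  have hpow : Tendsto (fun K : ℕ => c ^ (K + 1) / ((K + 1)! : ℝ)) atTop (𝓝 0) :=
    (tendsto_add_atTop_iff_nat 1).2 (FloorSemiring.tendsto_pow_div_factorial_atTop c)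
  -- `K` is fixed before `n`: both the truncation error of $e^{-c}$ and the limit of the Bonferroni
  -- error are below `ε / 4`. The convergence of the finitely many moments costs a third `ε / 4`.
  obtain ⟨K, hK1, hK2⟩ := ((Metric.tendsto_nhds.1 hexp (ε / 4) (by positivity)).and
    (hpow.eventually_lt_const (show 0 < ε / 4 by positivity))).exists
  have hsum : Tendsto (fun n => ∑ k ∈ range (K + 1), (-1) ^ k * β k n) atTop
      (𝓝 (∑ k ∈ range (K + 1), (-c) ^ k / (k ! : ℝ))) := by
    refine tendsto_finsetSum _ fun k _ => ?_
    rw [neg_pow c, mul_div_assoc]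
    exact (hβ k).const_mul _
  refine eventually_atTop.1 ?_
  filter_upwards [Metric.tendsto_nhds.1 hsum (ε / 4) (by positivity),
    (hβ (K + 1)).eventually_lt_const hK2] with n h1 h2
  have h3 := hbound K n
  rw [Real.dist_eq, abs_lt] at *
  rw [abs_le] at h3
  constructor <;> linarith

/-- The falling factorial counts `k`-tuples of distinct indices that satisfy `P ω`; the sum is then
counted by tuples instead of by points. -/
theorem sum_card_embedding_eq {Ω ι : Type*} [Fintype Ω] [Fintype ι] (P : Ω → ι → Prop) (k : ℕ) :
    ∑ ω, (Nat.card {i // P ω i}).descFactorial k =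
      ∑ e : Fin k ↪ ι, Nat.card {ω // ∀ j, P ω (e j)} := by
  classical
  have h1 : ∀ ω, (Nat.card {i // P ω i}).descFactorial k =
      #{e : Fin k ↪ ι | ∀ j, P ω (e j)} := by
    intro ω
    have := Fintype.card_embedding_eq (α := Fin k) (β := {i // P ω i})
    rw [Fintype.card_fin] at this
    rw [Nat.card_eq_fintype_card, ← this, ← Fintype.card_subtype]
    exact Fintype.card_congr (Equiv.codRestrict (Fin k) {i | P ω i}).symm
  rw [sum_congr rfl fun ω _ => h1 ω]
  simp only [Nat.card_eq_fintype_card, Fintype.card_subtype]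
  exact sum_card_bipartiteAbove_eq_sum_card_bipartiteBelow
    (r := fun ω (e : Fin k ↪ ι) => ∀ j, P ω (e j))

/-- Tuples of disjoint triples `(side, a, b)`. -/
def disjointTuple {S : Type*} {k : ℕ} (x : (Fin k → Bool) × (Fin k ⊕ Fin k ↪ S)) :
    Fin k ↪ Bool × S × S where
  toFun j := (x.1 j, x.2 (Sum.inl j), x.2 (Sum.inr j))
  inj' i j h := by
    have := x.2.injective (Prod.mk.inj (Prod.mk.inj h).2).1
    exact Sum.inl.inj this

theorem disjointTuple_injective {S : Type*} {k : ℕ} :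
    Function.Injective (disjointTuple (S := S) (k := k)) := by
  intro x y h
  have h' := fun j => DFunLike.congr_fun h j
  refine Prod.ext (funext fun j => congrArg Prod.fst (h' j)) (DFunLike.ext _ _ fun j => ?_)
  rcases j with j | j
  · exact congrArg (fun z => z.2.1) (h' j)
  · exact congrArg (fun z => z.2.2) (h' j)

namespace WeakOrder

noncomputable instance {S : Type*} [Finite S] : Fintype (WeakOrder S) := Fintype.ofFinite _

/-- The factorial moments of the number of links. -/
theorem exists_factorial_moment_bounds (k : ℕ) : ∃ C : ℝ, ∀ n : ℕ,
    C * fubini (n - k - 1) ≤ fubini (n - k) →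
    (n.descFactorial (2 * k) : ℝ) * (fubini (n - k) - C * fubini (n - k - 1)) ^ 2 ≤
      ∑ p : WeakOrder (Fin n) × WeakOrder (Fin n),
        ((Nat.card {i // Link p i}).descFactorial k : ℝ) ∧
    ∑ p : WeakOrder (Fin n) × WeakOrder (Fin n),
        ((Nat.card {i // Link p i}).descFactorial k : ℝ) ≤
      (n.descFactorial (2 * k) : ℝ) * (fubini (n - k) + C * fubini (n - k - 1)) ^ 2 +
        2 ^ k * ((n : ℝ) ^ (2 * k) - n.descFactorial (2 * k)) * fubini (n - k) ^ 2 := by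
  classical
  obtain ⟨C, hC, h⟩ := exists_card_disjoint_links k
  refine ⟨C, fun n hn => ?_⟩
  set f : ℝ := (fubini (n - k) : ℝ)
  set g : ℝ := C * (fubini (n - k - 1) : ℝ)
  have hg : 0 ≤ g := mul_nonneg hC (Nat.cast_nonneg _)
  let N : (Fin k ↪ Bool × Fin n × Fin n) → ℝ := fun e =>
    (Nat.card {p : WeakOrder (Fin n) × WeakOrder (Fin n) // ∀ j, Link p (e j)} : ℝ)
  have hM : ∑ p : WeakOrder (Fin n) × WeakOrder (Fin n),
      ((Nat.card {i // Link p i}).descFactorial k : ℝ) = ∑ e, N e := by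
    have := sum_card_embedding_eq
      (fun (p : WeakOrder (Fin n) × WeakOrder (Fin n)) i => Link p i) k
    simp only [N]
    exact_mod_cast this
  let D : Finset (Fin k ↪ Bool × Fin n × Fin n) := univ.image disjointTuple
  have hDcard : (#D : ℝ) = 2 ^ k * n.descFactorial (2 * k) := by
    rw [card_image_of_injective _ disjointTuple_injective, card_univ, Fintype.card_prod,
      Fintype.card_embedding_eq]
    simp [two_mul]
  have hNle : ∀ e, N e ≤ f ^ 2 := by
    intro e
    have := card_links_le e.injective
    rw [Nat.card_eq_fintype_card (α := Fin n), Fintype.card_fin, Fintype.card_fin] at this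
    simp only [N, f]
    exact_mod_cast this
  have hND : ∀ e ∈ D, (f - g) ^ 2 ≤ 2 ^ k * N e ∧ 2 ^ k * N e ≤ (f + g) ^ 2 := by
    intro e he
    obtain ⟨⟨σ, x⟩, -, rfl⟩ := mem_image.1 he
    obtain ⟨s, t, hs, ht, hst⟩ := h (Fin n) σ (fun j => x (Sum.inl j)) (fun j => x (Sum.inr j))
      (x.injective.comp Sum.inl_injective) (x.injective.comp Sum.inr_injective)
      (fun i j hij => by simpa using x.injective hij)
    rw [Nat.card_eq_fintype_card (α := Fin n), Fintype.card_fin, abs_le] at hs ht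
    have hst' : 2 ^ k * N (disjointTuple (σ, x)) = s * t := hst
    have h1 : f - g ≤ s := by linarith [hs.1]
    have h2 : f - g ≤ t := by linarith [ht.1]
    have h3 : s ≤ f + g := by linarith [hs.2]
    have h4 : t ≤ f + g := by linarith [ht.2]
    -- Nonnegativity is what allows the two lower bounds to be multiplied.
    have h5 : 0 ≤ f - g := sub_nonneg.2 hn
    rw [hst', sq, sq]
    exact ⟨mul_le_mul h1 h2 h5 (h5.trans h1),
      mul_le_mul h3 h4 (h5.trans h2) (h5.trans (h1.trans h3))⟩
  have h2k : (0 : ℝ) < 2 ^ k := by positivity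
  have hsplit : ∑ e, N e = ∑ e ∈ D, N e + ∑ e ∈ Dᶜ, N e := (sum_add_sum_compl D N).symm
  have hlow : (n.descFactorial (2 * k) : ℝ) * (f - g) ^ 2 ≤ ∑ e ∈ D, N e := by
    have := card_nsmul_le_sum D N ((f - g) ^ 2 / 2 ^ k) fun e he => by
      rw [div_le_iff₀' h2k]; exact (hND e he).1
    rw [nsmul_eq_mul, hDcard] at this
    refine le_trans (le_of_eq ?_) this
    field_simp
  have hupp : ∑ e ∈ D, N e ≤ (n.descFactorial (2 * k) : ℝ) * (f + g) ^ 2 := by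
    have := sum_le_card_nsmul D N ((f + g) ^ 2 / 2 ^ k) fun e he => by
      rw [le_div_iff₀' h2k]; exact (hND e he).2
    rw [nsmul_eq_mul, hDcard] at this
    refine this.trans (le_of_eq ?_)
    field_simp
  -- All other tuples: at most $(2n^2)^k$ minus the disjoint ones, so of lower order in $n$, each
  -- with the crude bound `f ^ 2`.
  have hcompl : ∑ e ∈ Dᶜ, N e ≤
      2 ^ k * ((n : ℝ) ^ (2 * k) - n.descFactorial (2 * k)) * f ^ 2 := by
    have h1 := sum_le_card_nsmul Dᶜ N (f ^ 2) fun e _ => hNle e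
    rw [nsmul_eq_mul] at h1
    refine h1.trans (mul_le_mul_of_nonneg_right ?_ (sq_nonneg f))
    have h2 : (#D : ℝ) + #Dᶜ = Fintype.card (Fin k ↪ Bool × Fin n × Fin n) := by
      exact_mod_cast card_add_card_compl D
    have h3 : (Fintype.card (Fin k ↪ Bool × Fin n × Fin n) : ℝ) ≤ (2 * (n * n)) ^ k := by
      rw [Fintype.card_embedding_eq]
      have := Nat.descFactorial_le_pow (Fintype.card (Bool × Fin n × Fin n))
        (Fintype.card (Fin k))
      simp only [Fintype.card_prod, Fintype.card_bool, Fintype.card_fin] at this ⊢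
      exact_mod_cast this
    have h4 : ((2 : ℝ) * (n * n)) ^ k = 2 ^ k * (n : ℝ) ^ (2 * k) := by
      rw [mul_pow, pow_mul, sq]
    rw [hDcard] at h2
    rw [h4] at h3
    rw [mul_sub]
    linarith
  have hpos : 0 ≤ ∑ e ∈ Dᶜ, N e := sum_nonneg fun e _ => Nat.cast_nonneg _
  rw [hM, hsplit]
  constructor <;> linarith

end WeakOrder

end

/-! ### Passage to the limit -/

section

open Filter Finset

theorem tendsto_natCast_add_div (j k : ℕ) :
    Tendsto (fun n : ℕ => ((n : ℝ) + j) / ((n : ℝ) + k + 1)) atTop (𝓝 1) := by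
  have h := tendsto_natCast_div_add_atTop (𝕜 := ℝ) ((k : ℝ) + 1)
  have h2 : Tendsto (fun n : ℕ => (j : ℝ) / ((n : ℝ) + k + 1)) atTop (𝓝 0) := by
    refine tendsto_const_nhds.div_atTop ?_
    simp only [add_assoc]
    exact tendsto_natCast_atTop_atTop.atTop_add tendsto_const_nhds
  have := h.add h2
  rw [add_zero] at this
  refine this.congr fun n => ?_
  rw [← add_assoc, add_div]

theorem tendsto_pow_mul_fubini_div (k : ℕ) :
    Tendsto (fun n : ℕ => (n : ℝ) ^ k * fubini (n - k) / fubini n) atTop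
      (𝓝 (Real.log 2 ^ k)) := by
  -- Shifting `n` by `k` removes the truncated subtraction, and the induction then multiplies
  -- successive ratios $n f_{n-1}/f_n\to\log 2$.
  suffices h : Tendsto (fun n : ℕ => ((n : ℝ) + k) ^ k * fubini n / fubini (n + k)) atTop
      (𝓝 (Real.log 2 ^ k)) by
    refine (tendsto_add_atTop_iff_nat k).1 (h.congr fun n => ?_)
    rw [Nat.add_sub_cancel]; push_cast; rfl
  induction k with
  | zero =>
    refine tendsto_const_nhds.congr fun n => ?_
    have : (fubini n : ℝ) ≠ 0 := by exact_mod_cast (fubini_pos n).ne'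
    simp [this]
  | succ k ih =>
    have h := (((tendsto_add_atTop_iff_nat 1).2 ih).mul (tendsto_natCast_add_div (k + 1) 0)).mul
      tendsto_fubini_ratio
    rw [mul_one, ← pow_succ] at h
    refine h.congr fun n => ?_
    have h1 : (fubini (n + 1) : ℝ) ≠ 0 := by exact_mod_cast (fubini_pos _).ne'
    have h2 : (n : ℝ) + 1 ≠ 0 := by positivity
    have h3 : n + 1 + k = n + (k + 1) := by ring
    rw [h3]
    push_cast
    have h4 : (fubini (n + (k + 1)) : ℝ) ≠ 0 := by exact_mod_cast (fubini_pos _).ne'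
    have h5 : (n : ℝ) + (k + 1) = n + 1 + k := by ring
    rw [h5]
    field_simp
    ring

theorem tendsto_descFactorial_div_pow (k : ℕ) :
    Tendsto (fun n : ℕ => (n.descFactorial k : ℝ) / (n : ℝ) ^ k) atTop (𝓝 1) := by
  induction k with
  | zero => simp
  | succ k ih =>
    have h : Tendsto (fun n : ℕ => ((n - k : ℕ) : ℝ) / n) atTop (𝓝 1) := by
      have h1 : Tendsto (fun n : ℕ => 1 - (k : ℝ) / n) atTop (𝓝 (1 - 0)) :=
        tendsto_const_nhds.sub (tendsto_const_div_atTop_nhds_zero_nat (k : ℝ))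
      rw [sub_zero] at h1
      refine h1.congr' ?_
      filter_upwards [eventually_ge_atTop k, eventually_gt_atTop 0] with n hn h0
      have : (n : ℝ) ≠ 0 := by exact_mod_cast h0.ne'
      rw [Nat.cast_sub hn, sub_div, div_self this]
    have h2 := h.mul ih
    rw [one_mul] at h2
    refine h2.congr fun n => ?_
    rw [Nat.descFactorial_succ, Nat.cast_mul, pow_succ', mul_div_mul_comm]

theorem tendsto_fubini_sub_div (k : ℕ) (c : ℝ) :
    Tendsto (fun n : ℕ => (n : ℝ) ^ k * (fubini (n - k) + c * fubini (n - k - 1)) / fubini n) atTop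
      (𝓝 (Real.log 2 ^ k)) := by
  have h1 := (tendsto_pow_mul_fubini_div (k + 1)).mul
    (tendsto_const_div_atTop_nhds_zero_nat c)
  rw [mul_zero] at h1
  have h2 := (tendsto_pow_mul_fubini_div k).add h1
  rw [add_zero] at h2
  refine h2.congr' ?_
  filter_upwards [eventually_gt_atTop 0] with n h0
  have : (n : ℝ) ≠ 0 := by exact_mod_cast h0.ne'
  have hf : (fubini n : ℝ) ≠ 0 := by exact_mod_cast (fubini_pos n).ne'
  rw [Nat.sub_sub]
  field_simp
  ring

theorem eventually_mul_fubini_le (k : ℕ) (c : ℝ) :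
    ∀ᶠ n : ℕ in atTop, c * fubini (n - k - 1) ≤ fubini (n - k) := by
  have hl := log_two_pos
  have h := (tendsto_fubini_sub_div k (-c)).eventually_const_lt (show 0 < Real.log 2 ^ k by positivity)
  filter_upwards [h, eventually_gt_atTop 0] with n hn h0
  by_contra! hlt
  refine hn.not_ge (div_nonpos_of_nonpos_of_nonneg ?_ (Nat.cast_nonneg _))
  exact mul_nonpos_of_nonneg_of_nonpos (by positivity) (by linarith)

theorem pairCount_eq (n : ℕ) : pairCount n = fubini n ^ 2 := by
  rw [pairCount, Nat.card_prod, fubini, sq]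

open WeakOrder

/-- Both bounds are rewritten with powers of $n$ matched to $f_{n-k}/f_n\sim(\log 2/n)^k$. The
overlapping tuples contribute the factor $1-(n)_{2k}/n^{2k}\to 0$. -/
theorem tendsto_factorial_moment (k : ℕ) :
    Tendsto (fun n : ℕ => (∑ p : WeakOrder (Fin n) × WeakOrder (Fin n),
        ((Nat.card {i // Link p i}).descFactorial k : ℝ)) /
      Fintype.card (WeakOrder (Fin n) × WeakOrder (Fin n))) atTop
      (𝓝 ((Real.log 2 ^ 2) ^ k)) := by
  obtain ⟨C, hC⟩ := exists_factorial_moment_bounds k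
  have hcard : ∀ n, (Fintype.card (WeakOrder (Fin n) × WeakOrder (Fin n)) : ℝ) =
      (fubini n : ℝ) ^ 2 := by
    intro n
    rw [← Nat.card_eq_fintype_card]
    exact_mod_cast pairCount_eq n
  have hd := tendsto_descFactorial_div_pow (2 * k)
  have hlo := hd.mul ((tendsto_fubini_sub_div k (-C)).pow 2)
  have hhi := (hd.mul ((tendsto_fubini_sub_div k C).pow 2)).add
    (((tendsto_const_nhds (x := (1 : ℝ))).sub hd).mul
      (((tendsto_fubini_sub_div k 0).pow 2).const_mul (2 ^ k)))
  have hL : (Real.log 2 ^ k) ^ 2 = (Real.log 2 ^ 2) ^ k := by rw [← pow_mul, ← pow_mul, mul_comm]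
  rw [one_mul, hL] at hlo
  rw [one_mul, sub_self, zero_mul, add_zero, hL] at hhi
  refine tendsto_of_tendsto_of_tendsto_of_le_of_le' hlo hhi ?_ ?_
  all_goals
    filter_upwards [eventually_mul_fubini_le k C, eventually_gt_atTop 0] with n hn h0
    have hn0 : (n : ℝ) ≠ 0 := by exact_mod_cast h0.ne'
    have hf : (0 : ℝ) < fubini n := by exact_mod_cast fubini_pos n
    obtain ⟨h1, h2⟩ := hC n hn
    have hn2 : (n : ℝ) ^ (2 * k) = ((n : ℝ) ^ k) ^ 2 := by rw [← pow_mul, mul_comm]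
    rw [hcard]
  · rw [le_div_iff₀ (by positivity)]
    refine le_trans (le_of_eq ?_) h1
    rw [hn2]
    field_simp
    ring
  · rw [div_le_iff₀ (by positivity)]
    refine h2.trans (le_of_eq ?_)
    rw [hn2]
    field_simp
    ring

theorem tendsto_card_no_link_div :
    Tendsto (fun n : ℕ =>
      (Nat.card {p : WeakOrder (Fin n) × WeakOrder (Fin n) // ∀ i, ¬ Link p i} : ℝ) / pairCount n)
      atTop (𝓝 (Real.exp (-(Real.log 2 ^ 2)))) := by
  classical
  refine (tendsto_card_eq_zero_of_tendsto_descFactorial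
    (fun n (p : WeakOrder (Fin n) × WeakOrder (Fin n)) => Nat.card {i // Link p i}) _
    tendsto_factorial_moment).congr fun n => ?_
  rw [pairCount, Nat.card_eq_fintype_card (α := WeakOrder (Fin n) × WeakOrder (Fin n)),
    Nat.card_eq_fintype_card, Fintype.card_subtype]
  congr 3
  ext p
  simp only [mem_filter, mem_univ, true_and, Nat.card_eq_fintype_card, Fintype.card_eq_zero_iff,
    isEmpty_subtype]

/-- After division by $f_n^2$ the bound is $2/n$ times a convergent sequence. -/
theorem tendsto_large_embedding_bound :
    Tendsto (fun n : ℕ => ((2 * (n ^ 4 * (fubini (n - 2) * fubini (n - 3)) +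
        2 * (n ^ 3 * (fubini (n - 2) * fubini (n - 2)))) : ℕ) : ℝ) / pairCount n)
      atTop (𝓝 0) := by
  have h2 := tendsto_pow_mul_fubini_div 2
  have h3 := tendsto_pow_mul_fubini_div 3
  have h0 := tendsto_const_div_atTop_nhds_zero_nat (2 : ℝ)
  have h := h0.mul ((h2.mul h3).add ((h2.mul h2).const_mul 2))
  rw [zero_mul] at h
  refine h.congr' ?_
  filter_upwards [eventually_gt_atTop 0] with n hn
  have hn0 : (n : ℝ) ≠ 0 := by exact_mod_cast hn.ne'
  have hf : (fubini n : ℝ) ≠ 0 := by exact_mod_cast (fubini_pos n).ne'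
  rw [pairCount_eq]
  push_cast
  field_simp

theorem tendsto_embeddingFreePairCount_div :
    Tendsto (fun n : ℕ => (embeddingFreePairCount n : ℝ) / pairCount n) atTop
      (𝓝 (Real.exp (-(Real.log 2 ^ 2)))) := by
  have h := tendsto_card_no_link_div.sub tendsto_large_embedding_bound
  rw [sub_zero] at h
  refine tendsto_of_tendsto_of_tendsto_of_le_of_le h tendsto_card_no_link_div
    (fun n => ?_) fun n => ?_
  · have h1 : (Nat.card {p : WeakOrder (Fin n) × WeakOrder (Fin n) // ∀ i, ¬ Link p i} : ℝ) ≤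
        embeddingFreePairCount n + (2 * (n ^ 4 * (fubini (n - 2) * fubini (n - 3)) +
          2 * (n ^ 3 * (fubini (n - 2) * fubini (n - 2)))) : ℕ) := by
      exact_mod_cast card_no_link_le n
    simp only [← sub_div]
    exact div_le_div_of_nonneg_right (by linarith) (Nat.cast_nonneg _)
  · exact div_le_div_of_nonneg_right (Nat.cast_le.2 (embeddingFreePairCount_le n))
      (Nat.cast_nonneg _)

theorem abs_exp_neg_log_two_sq_sub_lt : |Real.exp (-((Real.log 2) ^ 2)) - 0.62| < 0.005 := by
  have h1 := Real.log_two_gt_d9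
  have h2 := Real.log_two_lt_d9
  set x := Real.log 2 ^ 2
  have hx1 : 0.48 < x := by simp only [x]; nlinarith
  have hx2 : x < 0.481 := by simp only [x]; nlinarith
  -- Four Taylor terms suffice to place $e^x$ between $1/0.625$ and $1/0.615$.
  have hlow := Real.sum_le_exp_of_nonneg (show 0 ≤ 0.48 by norm_num) 4
  have hupp := Real.exp_bound' (show 0 ≤ 0.481 by norm_num) (by norm_num) (show 0 < 4 by norm_num)
  norm_num [sum_range_succ, Nat.factorial] at hlow hupp
  have h3 : Real.exp (12 / 25) < Real.exp x := Real.exp_lt_exp.2 (by linarith)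
  have h4 : Real.exp x < Real.exp (481 / 1000) := Real.exp_lt_exp.2 (by linarith)
  have hpos := Real.exp_pos x
  rw [Real.exp_neg, abs_lt]
  constructor
  · have : 0.615 < (Real.exp x)⁻¹ := by
      rw [lt_inv_comm₀ (by norm_num) hpos]; norm_num; linarith
    linarith
  · have : (Real.exp x)⁻¹ < 0.625 := by
      rw [inv_lt_comm₀ hpos (by norm_num)]; norm_num; linarith
    linarith

end

theorem mainTheorem3 :
    ((fun n : ℕ => (embeddingFreePairCount n : ℝ)) ~[Filter.atTop]
      (fun n : ℕ => Real.exp (-((Real.log 2) ^ 2)) * (pairCount n : ℝ))) ∧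
    (∀ n : ℕ, pairCount n = fubini n ^ 2) ∧
    ((fun n : ℕ => Real.exp (-((Real.log 2) ^ 2)) * (pairCount n : ℝ)) ~[Filter.atTop]
      (fun n : ℕ => Real.exp (-((Real.log 2) ^ 2)) *
        ((n ! : ℝ) ^ 2 / (4 * (Real.log 2) ^ (2 * n + 2))))) ∧
    Filter.Tendsto (fun n : ℕ => (embeddingFreePairCount n : ℝ) / (pairCount n : ℝ))
      Filter.atTop (𝓝 (Real.exp (-((Real.log 2) ^ 2)))) ∧
    |Real.exp (-((Real.log 2) ^ 2)) - 0.62| < 0.005 := by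
  have hl := log_two_pos
  have he := Real.exp_pos (-((Real.log 2) ^ 2))
  have hp : ∀ n, (pairCount n : ℝ) ≠ 0 := fun n => by
    rw [pairCount_eq]; exact_mod_cast (pow_pos (fubini_pos n) 2).ne'
  refine ⟨?_, pairCount_eq, ?_, tendsto_embeddingFreePairCount_div, abs_exp_neg_log_two_sq_sub_lt⟩
  · rw [Asymptotics.isEquivalent_iff_tendsto_one
      (Filter.Eventually.of_forall fun n => mul_ne_zero he.ne' (hp n))]
    have h := tendsto_embeddingFreePairCount_div.div_const (Real.exp (-((Real.log 2) ^ 2)))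
    rw [div_self he.ne'] at h
    refine h.congr fun n => ?_
    rw [Pi.div_apply, div_div, mul_comm (pairCount n : ℝ)]
  · rw [Asymptotics.isEquivalent_iff_tendsto_one
      (Filter.Eventually.of_forall fun n => by positivity)]
    have h := (tendsto_scaledFubini.mul_const (2 * Real.log 2)).pow 2
    rw [one_div_mul_cancel (by positivity), one_pow] at h
    refine h.congr fun n => ?_
    have : (n ! : ℝ) ≠ 0 := by positivity
    rw [Pi.div_apply, pairCount_eq, scaledFubini]
    push_cast
    field_simp
    ring
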